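/- Let $G$ be a finite simple graph with vertex set $V$, let $K$ be a field and let $S=K[x_v : v\in V]$. Let $I(G)\subset S$ be the edge ideal of $G$, generated by the monomials $x_ix_j$ with $\{i,j\}$ an edge of $G$, and for $k\ge 1$ let $I(G)^{[k]}$ be its $k$-th squarefree power, that is, the ideal generated by the squarefree monomials belonging to $I(G)^k$; equivalently, $I(G)^{[k]}$ is generated by the monomials $\prod_{v\in V(M)}x_v$, where $M$ runs over the $k$-matchings of $G$ (sets of $k$ pairwise disjoint edges) and $V(M)$ is the set of vertices covered by $M$. Let $\nu(G)$ be the matching number of $G$, the maximum size of a matching. The normalized depth function of $I(G)$ is $$g_{I(G)}(k)=\operatorname{depth}\bigl(S/I(G)^{[k]}\bigr)-(d_k-1),\qquad 1\le k\le\nu(G),$$ where $d_k$ is the minimum degree of a minimal monomial generator of $I(G)^{[k]}$ (so $d_k=2k$ and $g_{I(G)}(k)=\operatorname{depth}(S/I(G)^{[k]})-(2k-1)$), and the depth is the maximal length of an $S/I(G)^{[k]}$-regular sequence contained in the graded maximal ideal $(x_v : v\in V)$. If $G$ is a forest (that is, $G$ has no cycles), then $g_{I(G)}$ is non-increasing: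 $g_{I(G)}(l)\le g_{I(G)}(k)$ whenever $1\le k\le l\le\nu(G)$. -/

import Mathlib

open MvPolynomial

namespace SquarefreePowers

/-- The depth of a module `M` with respect to an ideal `J`: the supremum of the lengths of the
`M`-regular sequences whose terms all lie in `J`. -/
noncomputable def depth {R : Type*} [CommRing R] (J : Ideal R) (M : Type*) [AddCommGroup M]
    [Module R M] : ℕ∞ :=
  ⨆ rs ∈ {rs : List R | RingTheory.Sequence.IsRegular M rs ∧ ∀ r ∈ rs, r ∈ J}, (rs.length : ℕ∞)

/-- The depth of `S / I` for `S = K[x_v : v ∈ V]`, that is, its depth with respect to the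
graded maximal ideal `(x_v : v ∈ V)`, computed over `S`. -/
noncomputable def depthQuotient {V K : Type*} [Field K] (I : Ideal (MvPolynomial V K)) : ℕ∞ :=
  depth (idealOfVars V K) (MvPolynomial V K ⧸ I)

/-- The exponents of the minimal monomial generators of a monomial ideal `I`. -/
def minimalGenerators {V K : Type*} [Field K] (I : Ideal (MvPolynomial V K)) : Set (V →₀ ℕ) :=
  {a | Minimal (fun b : V →₀ ℕ => monomial b (1 : K) ∈ I) a}

/-- The initial degree of a nonzero monomial ideal `I`: the minimum degree of a minimal
monomial generator of `I`. -/
noncomputable def initialDegree {V K : Type*} [Field K] (I : Ideal (MvPolynomial V K)) : ℕ :=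
  sInf (Finsupp.degree '' minimalGenerators I)

/-- The `k`-th squarefree power `I^{[k]}`: the ideal generated by the squarefree monomials
of `I ^ k`. -/
noncomputable def squarefreePower {V K : Type*} [Field K] (I : Ideal (MvPolynomial V K)) (k : ℕ) :
    Ideal (MvPolynomial V K) :=
  Ideal.span {f | ∃ a : V →₀ ℕ, (∀ v, a v ≤ 1) ∧ f = monomial a 1 ∧ f ∈ I ^ k}

/-- The normalized depth function `g_I(k) = depth (S / I^{[k]}) - (d_k - 1)`, where `d_k` is the
initial degree of `I^{[k]}`. The depth is finite when `V` is finite,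
see `depthQuotient_ne_top`. -/
noncomputable def normalizedDepth {V K : Type*} [Field K] (I : Ideal (MvPolynomial V K)) (k : ℕ) :
    ℤ :=
  ((depthQuotient (squarefreePower I k)).toNat : ℤ) - ((initialDegree (squarefreePower I k) : ℤ) - 1)

/-- The edge ideal of `G`, generated by the monomials `x_i x_j` with `{i, j}` an edge. -/
noncomputable def edgeIdeal (K : Type*) [Field K] {V : Type*} (G : SimpleGraph V) :
    Ideal (MvPolynomial V K) :=
  Ideal.span {f | ∃ i j : V, G.Adj i j ∧ f = X i * X j}

/-- `M` is a `k`-matching of `G`: a set of `k` pairwise disjoint edges of `G`. -/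
structure IsKMatching {V : Type*} (G : SimpleGraph V) (k : ℕ) (M : Finset (Sym2 V)) : Prop where
  subset_edges : ∀ e ∈ M, e ∈ G.edgeSet
  card_eq : M.card = k
  disjoint : ∀ e ∈ M, ∀ e' ∈ M, e ≠ e' → ∀ v : V, v ∈ e → v ∉ e'

/-- The matching number of `G`: the maximum size of a matching of `G`. -/
noncomputable def matchingNumber {V : Type*} (G : SimpleGraph V) : ℕ :=
  sSup {k | ∃ M : Finset (Sym2 V), IsKMatching G k M}

open Classical in
/-- The vertex set `V(M)` of a set of edges `M`. -/
noncomputable def matchedVertices {V : Type*} [Fintype V] (M : Finset (Sym2 V)) : Finset V :=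
  Finset.univ.filter fun v => ∃ e ∈ M, v ∈ e

/-- The ideal generated by the monomials `x_{V(M)}`, the product of the `x_v` with `v ∈ V(M)`,
for all `k`-matchings `M` of `G`. -/
noncomputable def matchingIdeal (K : Type*) [Field K] {V : Type*} [Fintype V] (G : SimpleGraph V)
    (k : ℕ) : Ideal (MvPolynomial V K) :=
  Ideal.span {f | ∃ M : Finset (Sym2 V), IsKMatching G k M ∧ f = ∏ v ∈ matchedVertices M, X v}

/-! The depth is finite, and for edge ideals the notions above take their familiar form. -/

theorem length_le_supportDim {R : Type*} [CommRing R] [IsNoetherianRing R] (rs : List R) :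
    ∀ (M : Type _) [AddCommGroup M] [Module R M] [Module.Finite R M],
      RingTheory.Sequence.IsRegular M rs → (rs.length : WithBot ℕ∞) ≤ Module.supportDim R M := by
  induction rs with
  | nil =>
    intro M _ _ _ h
    have : Nontrivial M := by
      rw [← Submodule.nontrivial_iff R]
      exact ⟨⊤, _, h.top_ne_smul⟩
    have h1 := Module.supportDim_ne_bot_of_nontrivial R M
    obtain ⟨d, hd⟩ := WithBot.ne_bot_iff_exists.mp h1
    rw [← hd]
    simp
  | cons x rs ih =>
    intro M _ _ _ h
    rw [RingTheory.Sequence.isRegular_cons_iff] at h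
    have h1 := ih (QuotSMulTop x M) h.2
    have h2 := Module.supportDim_quotSMulTop_succ_le_of_notMem_minimalPrimes
      (R := R) (M := M) (x := x) (fun _ => h.1.notMem_of_mem_minimalPrimes)
    refine le_trans ?_ h2
    push_cast [List.length_cons]
    gcongr

theorem depthQuotient_le {V K : Type*} [Finite V] [Field K] (I : Ideal (MvPolynomial V K)) :
    depthQuotient I ≤ Nat.card V := by
  refine iSup₂_le fun rs hrs => ?_
  have h := (length_le_supportDim rs (MvPolynomial V K ⧸ I) hrs.1).trans
    (Module.supportDim_le_ringKrullDim _ _)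
  rw [MvPolynomial.ringKrullDim_of_isNoetherianRing, ringKrullDim_eq_zero_of_field, zero_add] at h
  exact_mod_cast h

theorem depthQuotient_ne_top {V K : Type*} [Finite V] [Field K] (I : Ideal (MvPolynomial V K)) :
    depthQuotient I ≠ ⊤ :=
  ne_top_of_le_ne_top (ENat.natCast_ne_top _) (depthQuotient_le I)

/-- The exponent of the monomial `x_A`. -/
noncomputable def expOf {V : Type*} (A : Finset V) : V →₀ ℕ := ∑ v ∈ A, Finsupp.single v 1

open Classical in
theorem expOf_apply {V : Type*} (A : Finset V) (v : V) : expOf A v = if v ∈ A then 1 else 0 := by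
  simp [expOf, Finsupp.finsetSum_apply, Finsupp.single_apply]

theorem prod_X_eq {V K : Type*} [Field K] (A : Finset V) :
    (∏ v ∈ A, X v : MvPolynomial V K) = monomial (expOf A) 1 := by
  rw [expOf, monomial_sum_one]; rfl

theorem degree_expOf {V : Type*} (A : Finset V) : (expOf A).degree = A.card := by
  simp [expOf, map_sum]

theorem mem_matchedVertices {V : Type*} [Fintype V] (M : Finset (Sym2 V)) (v : V) :
    v ∈ matchedVertices M ↔ ∃ e ∈ M, v ∈ e := by
  simp [matchedVertices]

open Classical in
theorem matchedVertices_insert {V : Type*} [Fintype V] (M : Finset (Sym2 V)) (i j : V) :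
    matchedVertices (insert s(i, j) M) = insert i (insert j (matchedVertices M)) := by
  ext v
  simp only [mem_matchedVertices, Finset.mem_insert]
  constructor
  · rintro ⟨e, rfl | he, hv⟩
    · rw [Sym2.mem_iff] at hv; tauto
    · exact Or.inr (Or.inr ⟨e, he, hv⟩)
  · rintro (rfl | rfl | ⟨e, he, hv⟩)
    · exact ⟨_, Or.inl rfl, Sym2.mem_mk_left _ _⟩
    · exact ⟨_, Or.inl rfl, Sym2.mem_mk_right _ _⟩
    · exact ⟨e, Or.inr he, hv⟩

open Classical in
theorem IsKMatching.insert {V : Type*} [Fintype V] {G : SimpleGraph V} {k : ℕ}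
    {M : Finset (Sym2 V)} (h : IsKMatching G k M) {i j : V} (hij : G.Adj i j)
    (hi : i ∉ matchedVertices M) (hj : j ∉ matchedVertices M) :
    IsKMatching G (k + 1) (insert s(i, j) M) := by
  rw [mem_matchedVertices] at hi hj
  have hn : s(i, j) ∉ M := fun hm => hi ⟨_, hm, Sym2.mem_mk_left _ _⟩
  refine ⟨?_, ?_, ?_⟩
  · intro e he
    rcases Finset.mem_insert.mp he with rfl | he
    · exact hij
    · exact h.subset_edges e he
  · rw [Finset.card_insert_of_notMem hn, h.card_eq]
  · intro e he e' he' hne v hv hv'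
    rcases Finset.mem_insert.mp he with h1 | h1 <;>
      rcases Finset.mem_insert.mp he' with h2 | h2
    · exact hne (h1.trans h2.symm)
    · subst h1
      rcases Sym2.mem_iff.mp hv with rfl | rfl
      · exact hi ⟨_, h2, hv'⟩
      · exact hj ⟨_, h2, hv'⟩
    · subst h2
      rcases Sym2.mem_iff.mp hv' with rfl | rfl
      · exact hi ⟨_, h1, hv⟩
      · exact hj ⟨_, h1, hv⟩
    · exact h.disjoint e h1 e' h2 hne v hv hv'

theorem IsKMatching.mono {V : Type*} {G : SimpleGraph V} {k : ℕ} {M N : Finset (Sym2 V)}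
    (h : IsKMatching G k M) (hN : N ⊆ M) : IsKMatching G N.card N :=
  ⟨fun e he => h.subset_edges e (hN he), rfl,
    fun e he e' he' => h.disjoint e (hN he) e' (hN he')⟩

open Classical in
theorem expOf_insert_insert {V : Type*} (A : Finset V) {i j : V} (hi : i ∉ A) (hj : j ∉ A)
    (hij : i ≠ j) :
    expOf (insert i (insert j A)) = Finsupp.single i 1 + Finsupp.single j 1 + expOf A := by
  rw [expOf, Finset.sum_insert (by simp [hi, hij]), Finset.sum_insert hj, expOf, add_assoc]

/-- Induction on a matching, one edge at a time. -/
theorem IsKMatching.exists_insert {V : Type*} [Fintype V] [DecidableEq V] {G : SimpleGraph V}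
    {k : ℕ} {M : Finset (Sym2 V)} (h : IsKMatching G (k + 1) M) :
    ∃ (i j : V) (N : Finset (Sym2 V)), G.Adj i j ∧ IsKMatching G k N ∧
      i ∉ matchedVertices N ∧ j ∉ matchedVertices N ∧ M = Insert.insert s(i, j) N := by
  obtain ⟨e, he⟩ : M.Nonempty := by
    rw [← Finset.card_pos, h.card_eq]; omega
  induction e using Sym2.ind with
  | _ i j =>
    have hc : (M.erase s(i, j)).card = k := by
      rw [Finset.card_erase_of_mem he, h.card_eq]; rfl
    refine ⟨i, j, M.erase s(i, j), h.subset_edges _ he, hc ▸ h.mono (Finset.erase_subset _ _),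
      ?_, ?_, (Finset.insert_erase he).symm⟩
    · rw [mem_matchedVertices]
      rintro ⟨e', he', hv⟩
      exact h.disjoint _ he _ (Finset.mem_of_mem_erase he') (Finset.ne_of_mem_erase he').symm i
        (Sym2.mem_mk_left _ _) hv
    · rw [mem_matchedVertices]
      rintro ⟨e', he', hv⟩
      exact h.disjoint _ he _ (Finset.mem_of_mem_erase he') (Finset.ne_of_mem_erase he').symm j
        (Sym2.mem_mk_right _ _) hv

theorem IsKMatching.card_matchedVertices {V : Type*} [Fintype V] {G : SimpleGraph V} :
    ∀ {k : ℕ} {M : Finset (Sym2 V)}, IsKMatching G k M → (matchedVertices M).card = 2 * k := by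
  classical
  intro k
  induction k with
  | zero =>
    intro M h
    rw [Finset.card_eq_zero.mp h.card_eq]
    simp [matchedVertices]
  | succ k ih =>
    intro M h
    obtain ⟨i, j, N, hij, hN, hi, hj, rfl⟩ := h.exists_insert
    rw [matchedVertices_insert, Finset.card_insert_of_notMem (by simp [hi, hij.ne]),
      Finset.card_insert_of_notMem hj, ih hN]
    omega

theorem IsKMatching.monomial_mem {V : Type*} [Fintype V] (K : Type*) [Field K]
    {G : SimpleGraph V} : ∀ {k : ℕ} {M : Finset (Sym2 V)}, IsKMatching G k M →
      (monomial (expOf (matchedVertices M)) 1 : MvPolynomial V K) ∈ edgeIdeal K G ^ k := by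
  classical
  intro k
  induction k with
  | zero => intro M _; simp
  | succ k ih =>
    intro M h
    obtain ⟨i, j, N, hij, hN, hi, hj, rfl⟩ := h.exists_insert
    rw [matchedVertices_insert, expOf_insert_insert _ hi hj hij.ne, pow_succ']
    have := Ideal.mul_mem_mul (I := edgeIdeal K G)
      (Ideal.subset_span ⟨i, j, hij, rfl⟩) (ih hN)
    simpa [X, monomial_mul] using this

theorem exists_matching_of_mem_pow {V : Type*} [Fintype V] {K : Type*} [Field K]
    {G : SimpleGraph V} {k : ℕ} {a : V →₀ ℕ} (ha : ∀ v, a v ≤ 1)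
    (hmem : (monomial a 1 : MvPolynomial V K) ∈ edgeIdeal K G ^ k) :
    ∃ M : Finset (Sym2 V), IsKMatching G k M ∧ expOf (matchedVertices M) ≤ a := by
  classical
  let T : ℕ → Set (V →₀ ℕ) := fun k => Nat.rec {0}
    (fun _ T => {b | ∃ i j c, G.Adj i j ∧ c ∈ T ∧
      b = Finsupp.single i 1 + Finsupp.single j 1 + c}) k
  have key : ∀ k, edgeIdeal K G ^ k ≤
      Ideal.span ((fun s => monomial s (1 : K)) '' T k) := by
    intro k
    induction k with
    | zero =>
      have : (1 : MvPolynomial V K) ∈ Ideal.span ((fun s => monomial s (1 : K)) '' T 0) :=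
        Ideal.subset_span ⟨0, rfl, rfl⟩
      rw [(Ideal.eq_top_iff_one _).mpr this]
      exact le_top
    | succ k ih =>
      rw [pow_succ']
      refine (Ideal.mul_mono_right ih).trans ?_
      rw [edgeIdeal, Ideal.span_mul_span', Ideal.span_le]
      rintro _ ⟨_, ⟨i, j, hij, rfl⟩, _, ⟨c, hc, rfl⟩, rfl⟩
      refine Ideal.subset_span ⟨_, ⟨i, j, c, hij, hc, rfl⟩, ?_⟩
      simp [X, monomial_mul]
  have h := mem_ideal_span_monomial_image.mp (key k hmem) a (by simp [mem_support_iff])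
  obtain ⟨b, hb, hba⟩ := h
  have fin : ∀ k, ∀ b ∈ T k, (∀ v, b v ≤ 1) →
      ∃ M : Finset (Sym2 V), IsKMatching G k M ∧ expOf (matchedVertices M) = b := by
    intro k
    induction k with
    | zero =>
      rintro b rfl _
      exact ⟨∅, ⟨by simp, by simp, by simp⟩, by simp [matchedVertices, expOf]⟩
    | succ k ih =>
      rintro b ⟨i, j, c, hij, hc, rfl⟩ hb1
      obtain ⟨N, hN, rfl⟩ := ih c hc (fun v => le_trans (by simp) (hb1 v))
      have hi : i ∉ matchedVertices N := fun hi => by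
        have := hb1 i
        simp [expOf_apply, hi] at this
      have hj : j ∉ matchedVertices N := fun hj => by
        have := hb1 j
        simp [expOf_apply, hj] at this
      refine ⟨_, hN.insert hij hi hj, ?_⟩
      rw [matchedVertices_insert, expOf_insert_insert _ hi hj hij.ne]
  obtain ⟨M, hM, rfl⟩ := fin k b hb (fun v => (hba v).trans (ha v))
  exact ⟨M, hM, hba⟩

/-- The `k`-th squarefree power of the edge ideal of `G` is generated by the monomials `x_{V(M)}`
for the `k`-matchings `M` of `G`. -/
theorem squarefreePower_edgeIdeal {V : Type*} [Fintype V] (K : Type*) [Field K]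
    (G : SimpleGraph V) (k : ℕ) :
    squarefreePower (edgeIdeal K G) k = matchingIdeal K G k := by
  classical
  refine le_antisymm (Ideal.span_le.mpr ?_) (Ideal.span_le.mpr ?_)
  · rintro _ ⟨a, ha, rfl, hmem⟩
    obtain ⟨M, hM, hle⟩ := exists_matching_of_mem_pow ha hmem
    have h1 : (monomial (expOf (matchedVertices M)) 1 : MvPolynomial V K) ∈ matchingIdeal K G k :=
      Ideal.subset_span ⟨M, hM, (prod_X_eq _).symm⟩
    exact Ideal.mem_of_dvd _ (monomial_dvd_monomial.mpr ⟨Or.inr hle, dvd_rfl⟩) h1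
  · rintro _ ⟨M, hM, rfl⟩
    rw [prod_X_eq]
    refine Ideal.subset_span ⟨_, fun v => ?_, rfl, hM.monomial_mem K⟩
    rw [expOf_apply]; split_ifs <;> simp

theorem bddAbove_matchings {V : Type*} [Fintype V] (G : SimpleGraph V) :
    BddAbove {k | ∃ M : Finset (Sym2 V), IsKMatching G k M} := by
  classical
  exact ⟨Fintype.card (Sym2 V), by rintro k ⟨M, hM⟩; exact hM.card_eq ▸ Finset.card_le_univ M⟩

theorem exists_isKMatching {V : Type*} [Fintype V] {G : SimpleGraph V} {k : ℕ}
    (hk : k ≤ matchingNumber G) : ∃ M : Finset (Sym2 V), IsKMatching G k M := by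
  obtain ⟨M, hM⟩ := Nat.sSup_mem (s := {k | ∃ M : Finset (Sym2 V), IsKMatching G k M})
    ⟨0, ∅, ⟨by simp, by simp, by simp⟩⟩ (bddAbove_matchings G)
  obtain ⟨N, hN, rfl⟩ := Finset.exists_subset_card_eq (hk.trans_eq hM.card_eq.symm)
  exact ⟨N, hM.mono hN⟩

theorem initialDegree_squarefreePower_edgeIdeal {V : Type*} [Fintype V] (K : Type*) [Field K]
    (G : SimpleGraph V) {k : ℕ} (hk : k ≤ matchingNumber G) :
    initialDegree (squarefreePower (edgeIdeal K G) k) = 2 * k := by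
  rw [squarefreePower_edgeIdeal]
  have hmem : ∀ M, IsKMatching G k M →
      (monomial (expOf (matchedVertices M)) 1 : MvPolynomial V K) ∈ matchingIdeal K G k :=
    fun M hM => Ideal.subset_span ⟨M, hM, (prod_X_eq _).symm⟩
  have hle : ∀ a, (monomial a 1 : MvPolynomial V K) ∈ matchingIdeal K G k →
      ∃ M, IsKMatching G k M ∧ expOf (matchedVertices M) ≤ a := by
    intro a ha
    have he : matchingIdeal K G k = Ideal.span ((fun s => monomial s (1 : K)) ''
        {s | ∃ M, IsKMatching G k M ∧ s = expOf (matchedVertices M)}) := by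
      rw [matchingIdeal]
      congr 1
      ext f
      constructor
      · rintro ⟨M, hM, rfl⟩; exact ⟨_, ⟨M, hM, rfl⟩, (prod_X_eq _).symm⟩
      · rintro ⟨_, ⟨M, hM, rfl⟩, rfl⟩; exact ⟨M, hM, (prod_X_eq _).symm⟩
    rw [he, mem_ideal_span_monomial_image] at ha
    obtain ⟨_, ⟨M, hM, rfl⟩, h⟩ := ha a (by
      classical
      rw [mem_support_iff, coeff_monomial, if_pos rfl]
      exact one_ne_zero)
    exact ⟨M, hM, h⟩
  have hset : Finsupp.degree '' minimalGenerators (matchingIdeal K G k) = {2 * k} := by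
    have hdeg : ∀ a ∈ minimalGenerators (matchingIdeal K G k), a.degree = 2 * k := by
      intro a ha
      replace ha : Minimal (fun b : V →₀ ℕ => monomial b (1 : K) ∈ matchingIdeal K G k) a := ha
      obtain ⟨M, hM, h⟩ := hle a ha.prop
      rw [← le_antisymm h (ha.le_of_le (hmem M hM) h), degree_expOf, hM.card_matchedVertices]
    refine Set.eq_singleton_iff_nonempty_unique_mem.mpr ⟨?_, ?_⟩
    · obtain ⟨M, hM⟩ := exists_isKMatching hk
      obtain ⟨a, -, ha⟩ := exists_minimal_le_of_wellFoundedLT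
        (fun b : V →₀ ℕ => (monomial b (1 : K)) ∈ matchingIdeal K G k) _ (hmem M hM)
      exact ⟨_, a, ha, rfl⟩
    · rintro _ ⟨a, ha, rfl⟩
      exact hdeg a ha
  rw [initialDegree, hset, csInf_singleton]

/-- For `k ≤ ν(G)` one has `g_{I(G)}(k) = depth (S / I(G)^{[k]}) - (2k - 1)`, where `I(G)^{[k]}` is
generated by the monomials `x_{V(M)}` for the `k`-matchings `M` of `G`. -/
theorem normalizedDepth_edgeIdeal {V : Type*} [Fintype V] (K : Type*) [Field K]
    (G : SimpleGraph V) {k : ℕ} (hk : k ≤ matchingNumber G) :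
    normalizedDepth (edgeIdeal K G) k =
      ((depthQuotient (matchingIdeal K G k)).toNat : ℤ) - (2 * k - 1) := by
  rw [normalizedDepth, initialDegree_squarefreePower_edgeIdeal K G hk, squarefreePower_edgeIdeal]
  push_cast
  rfl

end SquarefreePowers

/-!
Put `S = K[x_v : v ∈ V]`. The assertion is that `depth S / I(G)^{[k]}` grows by at
most two from `k` to `k + 1`, for `k < ν(G)`.

By the theorem of Rees, the depth of `M` is at least `t` if and only if `Ext^i(κ, M) = 0` for all
`i < t`, where `κ` is the residue field of the graded maximal ideal. A squarefree monomial ideal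
`I` is recorded by its family `F` of supports, closed under supersets. For a variable `x` let `A`
be the family of `I : x` and `C` that of the ideal generated by the monomials of `I` free of `x`.
The exact sequence `0 → S/C → S/A × S/C → S/F → 0` with maps `(1, -x)` and `(x, 1)`, together with
the fact that `x` acts as zero on `Ext(κ, -)`, carries the whole theory
(`isGluing_monomialIdeal`):
* the depth of `S/F` is at most those of `S/A` and of `S/C` (`DepthGE.colon`, `DepthGE.restrict`);
* it is at least `min (depth S/A) (depth S/C - 1)` (`DepthGE.of_colon_of_restrict`);
* it is at most `depth S/C - 1`, if the variables other than `x` can be removed one at a time such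
  that each of them, on its turn, divides out of `C` into `A` (`DepthGE.restrict_succ`).

In a forest with an edge there is a vertex `j` all of whose neighbours are leaves, `s ≥ 1` of them,
except possibly one further neighbour `b` (`exists_leafStar`). Let `W` be the set of vertices other
than `j` and its leaves. Removing `j` and its leaves one at a time bounds the depth for `G` and
`k + 1` from below by the depths for `G[W]` and `G[W \ b]` with `k` and `k + 1`, and from above by
those with `k`, with the same dependence on `s`. Induction on the number of vertices then proves
the theorem (`DepthGE.matchingFamily_of_succ`), unless `G[W \ b]` has no matching of the size that
the induction requires. In that case `k` is so close to the matching numbers of `G` and of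
`G[W \ b]` that two direct estimates apply, which the same recursion gives: the depth for `k` is at
least `2k - 1` plus the number of isolated vertices (`depthGE_of_card_le`), with equality for
`k = ν(G)` (`DepthGE.card_le`).
-/

namespace SquarefreePowers

universe u v

/-! ### Functoriality of `Ext^i(κ, -)` for modules -/

section

open CategoryTheory Abelian

/-- The vanishing of `Ext^i(κ, M)`. -/
def ExtVanish {R : Type u} [CommRing R] (κ : ModuleCat.{u} R) (M : Type u) [AddCommGroup M]
    [Module R M] (i : ℕ) : Prop :=
  Subsingleton (Ext κ (ModuleCat.of R M) i)

section Ext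

variable {R : Type u} [CommRing R] (κ : ModuleCat.{u} R)
  {M N P : Type u} [AddCommGroup M] [Module R M] [AddCommGroup N] [Module R N]
  [AddCommGroup P] [Module R P]

/-- The map `Ext^i(κ, M) → Ext^i(κ, N)` induced by `f : M → N`. -/
noncomputable def extMap (f : M →ₗ[R] N) (i : ℕ) :
    Ext κ (ModuleCat.of R M) i →+ Ext κ (ModuleCat.of R N) i :=
  (Ext.mk₀ (ModuleCat.ofHom f)).postcomp κ (add_zero i)

variable {κ}

theorem extMap_comp (g : N →ₗ[R] P) (f : M →ₗ[R] N) (i : ℕ) (e : Ext κ (ModuleCat.of R M) i) :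
    extMap κ (g ∘ₗ f) i e = extMap κ g i (extMap κ f i e) := by
  simp [extMap, ModuleCat.ofHom_comp]

theorem extMap_add (f g : M →ₗ[R] N) (i : ℕ) (e : Ext κ (ModuleCat.of R M) i) :
    extMap κ (f + g) i e = extMap κ f i e + extMap κ g i e := by
  simp [extMap, ModuleCat.ofHom_add, Ext.mk₀_add]

theorem extMap_id (i : ℕ) (e : Ext κ (ModuleCat.of R M) i) :
    extMap κ (LinearMap.id : M →ₗ[R] M) i e = e := by
  simp [extMap]

theorem extMap_smul_eq_zero {x : R} (hx : x ∈ Module.annihilator R κ) (f : M →ₗ[R] N) (i : ℕ)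
    (e : Ext κ (ModuleCat.of R M) i) : extMap κ (x • f) i e = 0 := by
  have h : x • 𝟙 κ = 0 := by
    ext a
    exact Module.mem_annihilator.mp hx a
  have h2 : ModuleCat.ofHom (x • f) = x • ModuleCat.ofHom f := rfl
  have h3 : (x • e) = 0 := by
    rw [← Ext.mk₀_id_comp e, ← Ext.smul_comp, ← Ext.mk₀_smul, h]; simp
  simp only [extMap, AddMonoidHom.flip_apply, Ext.postcomp, Ext.bilinearComp_apply_apply, h2, Ext.mk₀_smul,
    Ext.comp_smul]
  rw [← Ext.smul_comp, h3]; simp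

theorem extVanish_prod {i : ℕ} :
    ExtVanish κ (M × N) i ↔ ExtVanish κ M i ∧ ExtVanish κ N i := by
  refine ⟨fun h => ⟨⟨fun a b => ?_⟩, ⟨fun a b => ?_⟩⟩, fun h => ⟨fun a b => ?_⟩⟩
  · have : Subsingleton _ := h
    have e := fun a => extMap_comp (κ := κ) (LinearMap.fst R M N) (LinearMap.inl R M N) i a
    rw [LinearMap.fst_comp_inl] at e
    rw [← extMap_id i a, ← extMap_id i b, e, e,
      Subsingleton.elim (extMap κ (LinearMap.inl R M N) i a) (extMap κ (LinearMap.inl R M N) i b)]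
  · have : Subsingleton _ := h
    have e := fun a => extMap_comp (κ := κ) (LinearMap.snd R M N) (LinearMap.inr R M N) i a
    rw [LinearMap.snd_comp_inr] at e
    rw [← extMap_id i a, ← extMap_id i b, e, e,
      Subsingleton.elim (extMap κ (LinearMap.inr R M N) i a) (extMap κ (LinearMap.inr R M N) i b)]
  · have h1 : Subsingleton _ := h.1
    have h2 : Subsingleton _ := h.2
    have e : LinearMap.id = LinearMap.inl R M N ∘ₗ LinearMap.fst R M N +
        LinearMap.inr R M N ∘ₗ LinearMap.snd R M N := by ext <;> simp
    rw [← extMap_id i a, ← extMap_id i b, e, extMap_add, extMap_add, extMap_comp, extMap_comp,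
      extMap_comp, extMap_comp,
      Subsingleton.elim (extMap κ (LinearMap.fst R M N) i a) (extMap κ (LinearMap.fst R M N) i b),
      Subsingleton.elim (extMap κ (LinearMap.snd R M N) i a) (extMap κ (LinearMap.snd R M N) i b)]

end Ext

/-- An unbundled short exact sequence of `R`-modules is short exact in the category of modules. -/
theorem shortExact_ofHom {R : Type u} [CommRing R]
    {M N P : Type u} [AddCommGroup M] [Module R M] [AddCommGroup N] [Module R N]
    [AddCommGroup P] [Module R P] {f : M →ₗ[R] N} {g : N →ₗ[R] P}
    (hf : Function.Injective f) (hfg : Function.Exact f g) (hg : Function.Surjective g) :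
    (ShortComplex.mk (ModuleCat.ofHom f) (ModuleCat.ofHom g)
      (by ext x; exact hfg.apply_apply_eq_zero x)).ShortExact where
  exact := by
    rw [ShortComplex.ShortExact.moduleCat_exact_iff_function_exact]
    exact hfg
  mono_f := by rw [ModuleCat.mono_iff_injective]; exact hf
  epi_g := by rw [ModuleCat.epi_iff_surjective]; exact hg

end

/-! ### Long exact sequences and gluing -/

section

open CategoryTheory Abelian

section ShortExact

variable {R : Type u} [CommRing R] {κ : ModuleCat.{u} R}
  {M N P : Type u} [AddCommGroup M] [Module R M] [AddCommGroup N] [Module R N]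
  [AddCommGroup P] [Module R P] {f : M →ₗ[R] N} {g : N →ₗ[R] P}

theorem extMap_surjective_of_extVanish (hf : Function.Injective f) (hfg : Function.Exact f g)
    (hg : Function.Surjective g) {i : ℕ} (h : ExtVanish κ P i) :
    Function.Surjective (extMap κ f i) := by
  intro e
  exact Ext.covariant_sequence_exact₂ κ (shortExact_ofHom hf hfg hg) e
    (Subsingleton.elim (h := h) _ _)

theorem extMap_injective_of_extVanish (hf : Function.Injective f) (hfg : Function.Exact f g)
    (hg : Function.Surjective g) {i : ℕ} (h : ∀ j < i, ExtVanish κ P j) :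
    Function.Injective (extMap κ f i) := by
  rw [injective_iff_map_eq_zero]
  intro e he
  cases i with
  | zero =>
    have : Mono (ModuleCat.ofHom f) := (ModuleCat.mono_iff_injective _).mpr hf
    exact Ext.postcomp_mk₀_injective_of_mono κ (ModuleCat.ofHom f) (by simpa [extMap] using he)
  | succ i =>
    obtain ⟨e', he'⟩ := Ext.covariant_sequence_exact₁ κ (shortExact_ofHom hf hfg hg) e he rfl
    rw [← he', Subsingleton.elim (h := h i i.lt_succ_self) e' 0, Ext.zero_comp]

theorem extVanish_of_shortExact (hf : Function.Injective f) (hfg : Function.Exact f g)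
    (hg : Function.Surjective g) {i : ℕ} (hN : ExtVanish κ N i) (hM : ExtVanish κ M (i + 1)) :
    ExtVanish κ P i := by
  have key : ∀ e : Ext κ (ModuleCat.of R P) i, e = 0 := fun e => by
    obtain ⟨e', he'⟩ := Ext.covariant_sequence_exact₃ κ (shortExact_ofHom hf hfg hg) e rfl
      (Subsingleton.elim (h := hM) _ _)
    rw [← he', Subsingleton.elim (h := hN) e' 0, Ext.zero_comp]
  exact ⟨fun a b => (key a).trans (key b).symm⟩

end ShortExact

/-- The maps `φ : C → A`, `π : C → B` and `ψ : A → B` glue `B` from `A` and `C` along `x`: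
the sequence `0 → C → A × C → B → 0` with maps `(φ, -x)` and `(ψ, π)` is exact. -/
structure IsGluing {R : Type u} [CommRing R] (x : R) {A B C : Type u} [AddCommGroup A] [Module R A]
    [AddCommGroup B] [Module R B] [AddCommGroup C] [Module R C]
    (φ : C →ₗ[R] A) (π : C →ₗ[R] B) (ψ : A →ₗ[R] B) : Prop where
  injective : Function.Injective (φ.prod (-(x • LinearMap.id)))
  exact : Function.Exact (φ.prod (-(x • LinearMap.id))) (ψ.coprod π)
  surjective : Function.Surjective (ψ.coprod π)

namespace IsGluing

variable {R : Type u} [CommRing R] {κ : ModuleCat.{u} R} {x : R} {A B C : Type u}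
  [AddCommGroup A] [Module R A] [AddCommGroup B] [Module R B] [AddCommGroup C] [Module R C]
  {φ : C →ₗ[R] A} {π : C →ₗ[R] B} {ψ : A →ₗ[R] B}

theorem extMap_snd_eq_zero (φ : C →ₗ[R] A) (hx : x ∈ Module.annihilator R κ) {i : ℕ}
    (e : Ext κ (ModuleCat.of R C) i) :
    extMap κ (LinearMap.snd R A C) i (extMap κ (φ.prod (-(x • LinearMap.id))) i e) = 0 := by
  rw [← extMap_comp, LinearMap.snd_prod, ← smul_neg]
  exact extMap_smul_eq_zero hx _ _ _

theorem extVanish (h : IsGluing x φ π ψ) (hx : x ∈ Module.annihilator R κ) {i : ℕ}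
    (hB : ExtVanish κ B i) : ExtVanish κ A i ∧ ExtVanish κ C i := by
  have hs := extMap_surjective_of_extVanish h.injective h.exact h.surjective hB
  have hC : ExtVanish κ C i := by
    have key : ∀ e : Ext κ (ModuleCat.of R C) i, e = 0 := fun e => by
      obtain ⟨e', he'⟩ := hs (extMap κ (LinearMap.inr R A C) i e)
      have := extMap_snd_eq_zero φ hx e'
      rwa [he', ← extMap_comp, LinearMap.snd_comp_inr, extMap_id] at this
    exact ⟨fun a b => (key a).trans (key b).symm⟩
  have hAC : ExtVanish κ (A × C) i := by
    have : Subsingleton (Ext κ (ModuleCat.of R C) i) := hC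
    exact hs.subsingleton
  exact extVanish_prod.mp hAC

theorem extMap_injective (h : IsGluing x φ π ψ) (hx : x ∈ Module.annihilator R κ) {i : ℕ}
    (hB : ∀ j < i, ExtVanish κ B j) : Function.Injective (extMap κ φ i) := by
  have hi := extMap_injective_of_extVanish h.injective h.exact h.surjective hB
  rw [injective_iff_map_eq_zero] at hi ⊢
  intro e he
  refine hi e ?_
  set e' := extMap κ (φ.prod (-(x • LinearMap.id))) i e with he'
  have hid : (LinearMap.id : A × C →ₗ[R] A × C) = LinearMap.inl R A C ∘ₗ LinearMap.fst R A C +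
      LinearMap.inr R A C ∘ₗ LinearMap.snd R A C := by ext <;> simp
  rw [← extMap_id i e', hid, extMap_add, extMap_comp, extMap_comp, he', extMap_snd_eq_zero φ hx,
    ← extMap_comp (LinearMap.fst R A C), LinearMap.fst_prod, he]
  simp

theorem extVanish_of (h : IsGluing x φ π ψ) {i : ℕ}
    (hA : ExtVanish κ A i) (hC : ExtVanish κ C i) (hC' : ExtVanish κ C (i + 1)) :
    ExtVanish κ B i :=
  extVanish_of_shortExact h.injective h.exact h.surjective (extVanish_prod.mpr ⟨hA, hC⟩) hC'

/-- If a map `q` out of `B` composes with `ψ` to multiplication by `x`, then it vanishes on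
`Ext^i(κ, -)` as soon as `ψ` is injective there, for which `Ext^i(κ, C) = 0` suffices. -/
theorem extMap_eq_zero (h : IsGluing x φ π ψ) (hx : x ∈ Module.annihilator R κ) {i : ℕ}
    (hC : ExtVanish κ C i) (q : B →ₗ[R] A) (hq : ψ ∘ₗ q = x • LinearMap.id)
    (e : Ext κ (ModuleCat.of R B) i) : extMap κ q i e = 0 := by
  have h0 : extMap κ (ψ.coprod π) i (extMap κ (LinearMap.inl R A C) i (extMap κ q i e)) = 0 := by
    rw [← extMap_comp, ← extMap_comp, LinearMap.coprod_inl, hq]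
    exact extMap_smul_eq_zero hx _ _ _
  obtain ⟨e', he'⟩ := Ext.covariant_sequence_exact₂ κ
    (shortExact_ofHom h.injective h.exact h.surjective) _ h0
  rw [Subsingleton.elim (h := hC) e' 0, Ext.zero_comp] at he'
  have h1 := extMap_comp (LinearMap.fst R A C) (LinearMap.inl R A C) i (extMap κ q i e)
  rw [LinearMap.fst_comp_inl, extMap_id] at h1
  rw [h1, ← he', map_zero]

end IsGluing

end

/-! ### Squarefree monomial ideals as families of vertex sets -/

section

variable {V : Type u} {K : Type v} [Field K]

/-- The squarefree monomial ideal of a family `F` of vertex sets that is closed under supersets: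
it is spanned by the monomials whose support lies in `F`. -/
noncomputable def monomialIdeal (K : Type v) [Field K] (F : UpperSet (Finset V)) :
    Ideal (MvPolynomial V K) :=
  Ideal.span ((fun a => monomial a (1 : K)) '' {a : V →₀ ℕ | a.support ∈ F})

theorem mem_monomialIdeal {F : UpperSet (Finset V)} {f : MvPolynomial V K} :
    f ∈ monomialIdeal K F ↔ ∀ a ∈ f.support, a.support ∈ F := by
  rw [monomialIdeal, mem_ideal_span_monomial_image]
  refine forall₂_congr fun a _ => ⟨?_, fun h => ⟨a, h, le_rfl⟩⟩
  rintro ⟨b, hb, hba⟩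
  exact F.upper (Finsupp.support_mono hba) hb

theorem monomialIdeal_mono {F F' : UpperSet (Finset V)} (h : ∀ A ∈ F, A ∈ F') :
    monomialIdeal K F ≤ monomialIdeal K F' := fun _ hf =>
  mem_monomialIdeal.mpr fun a ha => h _ (mem_monomialIdeal.mp hf a ha)

variable [DecidableEq V]

/-- The family of the colon ideal by the variable `x`. -/
def colon (F : UpperSet (Finset V)) (x : V) : UpperSet (Finset V) :=
  ⟨{A | insert x A ∈ F}, fun _ _ h hA => F.upper (Finset.insert_subset_insert x h) hA⟩

/-- The family of the ideal generated by the monomials of the ideal of `F` that do not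
involve `x`. -/
def restrict (F : UpperSet (Finset V)) (x : V) : UpperSet (Finset V) :=
  ⟨{A | A.erase x ∈ F}, fun _ _ h hA => F.upper (Finset.erase_subset_erase x h) hA⟩

@[simp] theorem mem_colon {F : UpperSet (Finset V)} {x : V} {A : Finset V} :
    A ∈ colon F x ↔ insert x A ∈ F := Iff.rfl

@[simp] theorem mem_restrict {F : UpperSet (Finset V)} {x : V} {A : Finset V} :
    A ∈ restrict F x ↔ A.erase x ∈ F := Iff.rfl

theorem mem_of_mem_restrict {F : UpperSet (Finset V)} {x : V} {A : Finset V}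
    (h : A ∈ restrict F x) : A ∈ F := F.upper (Finset.erase_subset x A) h

theorem mem_colon_of_mem {F : UpperSet (Finset V)} {x : V} {A : Finset V}
    (h : A ∈ F) : A ∈ colon F x := F.upper (Finset.subset_insert x A) h

theorem support_add_single (a : V →₀ ℕ) (x : V) :
    (a + Finsupp.single x 1).support = insert x a.support := by
  ext v
  by_cases h : v = x <;> simp [h, Ne.symm]

theorem X_mul_mem_iff {F : UpperSet (Finset V)} {x : V} {f : MvPolynomial V K} :
    X x * f ∈ monomialIdeal K F ↔ f ∈ monomialIdeal K (colon F x) := by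
  rw [mem_monomialIdeal, mem_monomialIdeal]
  simp [support_X_mul, support_add_single, add_comm (Finsupp.single x 1)]

theorem monomialIdeal_le_sup (F : UpperSet (Finset V)) (x : V) :
    monomialIdeal K F ≤ monomialIdeal K (restrict F x) ⊔
      Ideal.span {X x} * monomialIdeal K (colon F x) := by
  refine Ideal.span_le.mpr ?_
  rintro _ ⟨a, ha, rfl⟩
  by_cases hx : a x = 0
  · refine Ideal.mem_sup_left (Ideal.subset_span ⟨a, ?_, rfl⟩)
    have : x ∉ a.support := by simpa using hx
    simpa [Finset.erase_eq_of_notMem this] using ha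
  · refine Ideal.mem_sup_right ?_
    rw [Ideal.mem_span_singleton_mul]
    have e : a - Finsupp.single x 1 + Finsupp.single x 1 = a :=
      tsub_add_cancel_of_le (by simpa [Nat.one_le_iff_ne_zero] using hx)
    refine ⟨monomial (a - Finsupp.single x 1) 1, Ideal.subset_span ⟨_, ?_, rfl⟩, ?_⟩
    · simpa [← support_add_single, e] using ha
    · rw [X, monomial_mul, add_comm, e, one_mul]

theorem restrict_le (F : UpperSet (Finset V)) (x : V) :
    monomialIdeal K (restrict F x) ≤ monomialIdeal K F :=
  monomialIdeal_mono fun _ => mem_of_mem_restrict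

theorem restrict_le_colon (F : UpperSet (Finset V)) (x : V) :
    monomialIdeal K (restrict F x) ≤ monomialIdeal K (colon F x) :=
  monomialIdeal_mono fun _ h => mem_colon_of_mem (mem_of_mem_restrict h)

/-- Multiplication by `x` from `S / (I : x)` to `S / I`. -/
noncomputable def mulVar (K : Type v) [Field K] (F : UpperSet (Finset V)) (x : V) :
    (MvPolynomial V K ⧸ monomialIdeal K (colon F x)) →ₗ[MvPolynomial V K]
      (MvPolynomial V K ⧸ monomialIdeal K F) :=
  Submodule.mapQ _ _ (LinearMap.lsmul _ _ (X x)) fun _ h => X_mul_mem_iff.mpr h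

theorem isGluing_monomialIdeal (F : UpperSet (Finset V)) (x : V) :
    IsGluing (X x : MvPolynomial V K) (Submodule.factor (restrict_le_colon (K := K) F x))
      (Submodule.factor (restrict_le F x)) (mulVar K F x) where
  injective := by
    rw [injective_iff_map_eq_zero]
    intro c hc
    obtain ⟨c, rfl⟩ := Submodule.Quotient.mk_surjective _ c
    have h2 := congrArg Prod.snd hc
    simp only [LinearMap.prod_apply, LinearMap.neg_apply, LinearMap.smul_apply, LinearMap.id_apply,
      Function.prod_apply, Prod.snd_zero, neg_eq_zero] at h2
    rw [← Submodule.Quotient.mk_smul, Submodule.Quotient.mk_eq_zero, smul_eq_mul, X_mul_mem_iff,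
      mem_monomialIdeal] at h2
    rw [Submodule.Quotient.mk_eq_zero, mem_monomialIdeal]
    intro a ha
    have := h2 a ha
    simp only [mem_colon, mem_restrict] at this ⊢
    rwa [Finset.erase_insert_eq_erase] at this
  exact := by
    rintro ⟨a, c⟩
    obtain ⟨a, rfl⟩ := Submodule.Quotient.mk_surjective _ a
    obtain ⟨c, rfl⟩ := Submodule.Quotient.mk_surjective _ c
    constructor
    · intro h
      replace h : Submodule.Quotient.mk (X x * a + c) = (0 : _ ⧸ monomialIdeal K F) := h
      rw [Submodule.Quotient.mk_eq_zero] at h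
      -- if `x a + c = c' + x a'`, then `(a, c)` is the image of `a - a'`
      obtain ⟨c', hc', d, hd, hcd⟩ := Submodule.mem_sup.mp (monomialIdeal_le_sup F x h)
      obtain ⟨a', ha', rfl⟩ := Ideal.mem_span_singleton_mul.mp hd
      refine ⟨Submodule.Quotient.mk (a - a'), Prod.ext ?_ ?_⟩
      · change Submodule.Quotient.mk (a - a') = _
        rw [Submodule.Quotient.eq]
        simpa using ha'
      · change -((X x : MvPolynomial V K) • (Submodule.Quotient.mk (a - a') :
          _ ⧸ monomialIdeal K (restrict F x))) = _
        rw [← Submodule.Quotient.mk_smul, ← Submodule.Quotient.mk_neg, Submodule.Quotient.eq]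
        have : -((X x : MvPolynomial V K) • (a - a')) - c = -c' := by
          rw [smul_eq_mul]; linear_combination hcd
        rw [this]
        exact neg_mem hc'
    · rintro ⟨u, hu⟩
      obtain ⟨u, rfl⟩ := Submodule.Quotient.mk_surjective _ u
      rw [← hu]
      change (Submodule.Quotient.mk (X x * u) : _ ⧸ monomialIdeal K F) +
        Submodule.factor (restrict_le F x) (-((X x : MvPolynomial V K) • Submodule.Quotient.mk u)) = 0
      rw [map_neg, map_smul]
      exact add_neg_cancel _
  surjective := by
    intro b
    obtain ⟨b, rfl⟩ := Submodule.Quotient.mk_surjective _ b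
    exact ⟨(0, Submodule.Quotient.mk b), by simp⟩

end

/-! ### Depth of squarefree monomial ideals -/

section

open CategoryTheory Abelian

/-- The residue field `S / (x_v : v ∈ V)` as an `S`-module. -/
noncomputable abbrev residueModule (V : Type u) (K : Type v) [Field K] :
    ModuleCat.{max u v} (MvPolynomial V K) :=
  ModuleCat.of _ (MvPolynomial V K ⧸ idealOfVars V K)

/-- The groups `Ext^i(K, S / I_F)` vanish for all `i < t`. By the theorem of Rees this says that
the depth of `S / I_F` is at least `t`, if the ideal `I_F` is proper. -/
def DepthGE {V : Type u} (K : Type v) [Field K] (F : UpperSet (Finset V)) (t : ℕ) : Prop :=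
  ∀ i < t, ExtVanish (residueModule V K) (MvPolynomial V K ⧸ monomialIdeal K F) i

variable {V : Type u} {K : Type v} [Field K]

theorem X_mem_annihilator (x : V) :
    (X x : MvPolynomial V K) ∈ Module.annihilator _ (residueModule V K) := by
  have : (X x : MvPolynomial V K) ∈ idealOfVars V K := Ideal.subset_span ⟨x, rfl⟩
  rw [← Ideal.annihilator_quotient (I := idealOfVars V K)] at this
  exact this

theorem extVanish_of_subsingleton {R : Type u} [CommRing R] (κ : ModuleCat.{u} R) (M : Type u)
    [AddCommGroup M] [Module R M] [Subsingleton M] (i : ℕ) : ExtVanish κ M i := by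
  have key : ∀ e : Ext κ (ModuleCat.of R M) i, e = 0 := fun e => by
    rw [← extMap_id i e, Subsingleton.elim (LinearMap.id : M →ₗ[R] M) ((0 : R) • LinearMap.id)]
    exact extMap_smul_eq_zero (Submodule.zero_mem _) _ _ _
  exact ⟨fun a b => (key a).trans (key b).symm⟩

theorem extVanish_of_mem (F : UpperSet (Finset V)) (h : ∅ ∈ F) (i : ℕ) :
    ExtVanish (residueModule V K) (MvPolynomial V K ⧸ monomialIdeal K F) i := by
  have : monomialIdeal K F = ⊤ := by
    rw [eq_top_iff]
    intro f _
    exact mem_monomialIdeal.mpr fun a _ => F.upper (Finset.empty_subset _) h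
  have : Subsingleton (MvPolynomial V K ⧸ monomialIdeal K F) := by
    rw [this]; infer_instance
  exact extVanish_of_subsingleton _ _ _

theorem DepthGE.of_empty_mem {F : UpperSet (Finset V)} (h : ∅ ∈ F) (t : ℕ) : DepthGE K F t :=
  fun i _ => extVanish_of_mem F h i

theorem DepthGE.mono {F : UpperSet (Finset V)} {s t : ℕ} (h : DepthGE K F t) (hst : s ≤ t) :
    DepthGE K F s := fun i hi => h i (hi.trans_le hst)

variable [DecidableEq V]

theorem DepthGE.colon {F : UpperSet (Finset V)} {t : ℕ} (h : DepthGE K F t) (x : V) :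
    DepthGE K (colon F x) t := fun i hi =>
  ((isGluing_monomialIdeal F x).extVanish (X_mem_annihilator x) (h i hi)).1

theorem DepthGE.restrict {F : UpperSet (Finset V)} {t : ℕ} (h : DepthGE K F t) (x : V) :
    DepthGE K (restrict F x) t := fun i hi =>
  ((isGluing_monomialIdeal F x).extVanish (X_mem_annihilator x) (h i hi)).2

/-- The lower bound for the depth of `S / I_F` by splitting off a variable. -/
theorem DepthGE.of_colon_of_restrict {F : UpperSet (Finset V)} {t : ℕ} (x : V)
    (h : DepthGE K (SquarefreePowers.colon F x) t)
    (h' : DepthGE K (SquarefreePowers.restrict F x) (t + 1)) : DepthGE K F t := fun i hi =>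
  (isGluing_monomialIdeal F x).extVanish_of (h i hi) (h' i (by omega)) (h' (i + 1) (by omega))

/-- If `S / I_F` has depth at least `t`, then the group `Ext^t` that could obstruct depth `t + 1`
for the restriction to `x = 0` embeds into the one for the colon ideal. -/
theorem DepthGE.extMap_injective {F : UpperSet (Finset V)} {t : ℕ} (h : DepthGE K F t) (x : V) :
    Function.Injective (extMap (residueModule V K)
      (Submodule.factor (restrict_le_colon (K := K) F x)) t) :=
  (isGluing_monomialIdeal F x).extMap_injective (X_mem_annihilator x) h

omit [DecidableEq V] in
theorem DepthGE.succ_of_extVanish {F : UpperSet (Finset V)} {t : ℕ} (h : DepthGE K F t)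
    (h' : ExtVanish (residueModule V K) (MvPolynomial V K ⧸ monomialIdeal K F) t) :
    DepthGE K F (t + 1) := fun i hi => by
  rcases Nat.lt_succ_iff_lt_or_eq.mp hi with hi | rfl
  · exact h i hi
  · exact h'

theorem DepthGE.restrict_succ_of_singleton_mem {F : UpperSet (Finset V)} {t : ℕ}
    (h : DepthGE K F t) {x : V} (hx : {x} ∈ F) :
    DepthGE K (SquarefreePowers.restrict F x) (t + 1) := by
  refine (h.restrict x).succ_of_extVanish ?_
  have : Subsingleton _ := extVanish_of_mem (K := K) (SquarefreePowers.colon F x) (by simpa using hx) t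
  exact (h.extMap_injective x).subsingleton

theorem mulVar_comp_factor (F : UpperSet (Finset V)) (y : V)
    (h : monomialIdeal K F ≤ monomialIdeal K (SquarefreePowers.colon F y)) :
    mulVar K F y ∘ₗ Submodule.factor h = (X y : MvPolynomial V K) • LinearMap.id := by
  refine Submodule.linearMap_qext _ (LinearMap.ext fun f => ?_)
  simp only [LinearMap.comp_apply, Submodule.mkQ_apply, mulVar, LinearMap.smul_apply,
    LinearMap.id_apply]
  exact (Submodule.mapQ_apply _ _ _ f).trans (Submodule.Quotient.mk_smul _ (X y) f)

/-- A criterion for the restriction to `x = 0` to have larger depth than `S / I_F`. Let `C` be the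
restricted ideal, and suppose that `C : y` lies in `I_F : x`. Then the map of
`DepthGE.extMap_injective` factors through `S / C → S / (C : y)`. Followed by the multiplication
`y : S / (C : y) → S / C`, which is injective on `Ext^t` by `h'`, this becomes multiplication by
`y` on `S / C`, which is zero on `Ext^t`. So the map is both injective and zero. -/
theorem DepthGE.restrict_succ {F : UpperSet (Finset V)} {t : ℕ} (h : DepthGE K F t) (x y : V)
    (hy : ∀ A, (insert y A).erase x ∈ F → insert x A ∈ F)
    (h' : DepthGE K (SquarefreePowers.restrict (SquarefreePowers.restrict F x) y) (t + 1)) :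
    DepthGE K (SquarefreePowers.restrict F x) (t + 1) := by
  have hCy : monomialIdeal K (SquarefreePowers.colon (SquarefreePowers.restrict F x) y) ≤
      monomialIdeal K (SquarefreePowers.colon F x) := monomialIdeal_mono hy
  have hle : monomialIdeal K (SquarefreePowers.restrict F x) ≤
      monomialIdeal K (SquarefreePowers.colon (SquarefreePowers.restrict F x) y) :=
    monomialIdeal_mono fun _ => mem_colon_of_mem
  have hcomp : Submodule.factor (restrict_le_colon (K := K) F x) =
      Submodule.factor hCy ∘ₗ Submodule.factor hle := (Submodule.factor_comp hle hCy).symm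
  have hzero : ∀ e, extMap (residueModule V K)
      (Submodule.factor (restrict_le_colon (K := K) F x)) t e = 0 := by
    intro e
    rw [hcomp, extMap_comp, (isGluing_monomialIdeal _ y).extMap_eq_zero (X_mem_annihilator y)
      (h' t t.lt_succ_self) (Submodule.factor hle) (mulVar_comp_factor _ _ _), map_zero]
  exact (h.restrict x).succ_of_extVanish
    ⟨fun a b => h.extMap_injective x ((hzero a).trans (hzero b).symm)⟩

/-- Restricting to `x = 0` for all variables `x` turns a proper ideal into the zero ideal. -/
theorem DepthGE.top_of_empty_notMem [Fintype V] {F : UpperSet (Finset V)} {t : ℕ}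
    (h : DepthGE K F t) (hF : ∅ ∉ F) : DepthGE K (⊤ : UpperSet (Finset V)) t := by
  have key : ∀ s : Finset V, ∃ F' : UpperSet (Finset V), (∀ A, A ∈ F' ↔ A \ s ∈ F) ∧
      DepthGE K F' t := by
    intro s
    induction s using Finset.induction_on with
    | empty => exact ⟨F, by simp, h⟩
    | insert x s hx ih =>
      obtain ⟨F', hF', h'⟩ := ih
      refine ⟨_, fun A => ?_, h'.restrict x⟩
      rw [mem_restrict, hF', Finset.erase_sdiff_comm, Finset.sdiff_insert]
  obtain ⟨F', hF', h'⟩ := key Finset.univ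
  have : F' = ⊤ := by
    ext A
    simpa [hF', Finset.sdiff_eq_empty_iff_subset.mpr (Finset.subset_univ A)] using hF
  exact this ▸ h'

/-- If `I_F` is a nonzero proper ideal, the depth of `S / I_F` is less than that of `S`. -/
theorem DepthGE.top_succ [Fintype V] {t : ℕ} (A : Finset V) : ∀ {F : UpperSet (Finset V)},
    DepthGE K F t → A ∈ F → ∅ ∉ F → DepthGE K (⊤ : UpperSet (Finset V)) (t + 1) := by
  induction A using Finset.induction_on with
  | empty => intro F _ h h'; exact absurd h h'
  | insert x A hx ih =>
    intro F h hA hF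
    by_cases hxF : {x} ∈ F
    · refine (h.restrict_succ_of_singleton_mem hxF).top_of_empty_notMem ?_
      simpa using hF
    · exact ih (h.colon x) hA (by simpa using hxF)

/-- The family of the ideal generated by the variables in `W`. -/
def variableFamily (W : Finset V) : UpperSet (Finset V) :=
  ⟨{A | (A ∩ W).Nonempty}, fun _ _ h hA => hA.mono (Finset.inter_subset_inter_right h)⟩

theorem mem_variableFamily {W A : Finset V} : A ∈ variableFamily W ↔ (A ∩ W).Nonempty := Iff.rfl

theorem restrict_variableFamily {W : Finset V} {x : V} (hx : x ∉ W) :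
    restrict (variableFamily (insert x W)) x = variableFamily W := by
  ext A
  have : A.erase x ∩ insert x W = A ∩ W := by
    ext v
    by_cases hv : v = x <;> simp [hv, hx]
  simp [mem_variableFamily, this]

theorem variableFamily_empty : variableFamily (∅ : Finset V) = ⊤ := by
  ext A
  simp [mem_variableFamily]

theorem depthGE_variableFamily (W : Finset V) : ∀ t, DepthGE K (variableFamily W) t ↔
    DepthGE K (⊤ : UpperSet (Finset V)) (t + W.card) := by
  induction W using Finset.induction_on with
  | empty => simp [variableFamily_empty]
  | insert x W hx ih =>
    intro t
    have hxm : {x} ∈ variableFamily (insert x W) := ⟨x, by simp⟩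
    rw [Finset.card_insert_of_notMem hx, ← add_assoc, add_right_comm, ← ih,
      ← restrict_variableFamily hx]
    exact ⟨fun h => h.restrict_succ_of_singleton_mem hxm, fun h =>
      DepthGE.of_colon_of_restrict x (.of_empty_mem (by simpa using hxm) _) h⟩

theorem depthGE_top_iff [Fintype V] {t : ℕ} :
    DepthGE K (⊤ : UpperSet (Finset V)) t ↔ t ≤ Fintype.card V := by
  constructor
  · intro h
    by_contra! hlt
    have h1 := (depthGE_variableFamily (K := K) Finset.univ 1).mpr (h.mono (by
      rw [Finset.card_univ]; omega)) 0 one_pos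
    have hle : idealOfVars V K ≤ monomialIdeal K (variableFamily Finset.univ) := by
      refine Ideal.span_le.mpr ?_
      rintro _ ⟨x, rfl⟩
      exact Ideal.subset_span ⟨Finsupp.single x 1, by
        simp [mem_variableFamily], rfl⟩
    have h2 : ModuleCat.ofHom (Submodule.factor hle) = 0 := by
      rw [← Ext.mk₀_eq_zero_iff]
      exact Subsingleton.elim (h := h1) _ _
    have h3 : (Submodule.Quotient.mk (1 : MvPolynomial V K) :
        _ ⧸ monomialIdeal K (variableFamily (Finset.univ : Finset V))) = 0 :=
      congrArg (fun f => f.hom (Submodule.Quotient.mk 1)) h2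
    rw [Submodule.Quotient.mk_eq_zero, mem_monomialIdeal] at h3
    have := h3 0 (by simp)
    simp [mem_variableFamily] at this
  · intro h
    have h1 := (depthGE_variableFamily (K := K) (Finset.univ : Finset V) 0).mp (by
      intro i hi; omega)
    exact h1.mono (by simpa using h)

theorem DepthGE.lt_card [Fintype V] {F : UpperSet (Finset V)} {t : ℕ} (h : DepthGE K F t)
    {A : Finset V} (hA : A ∈ F) (hF : ∅ ∉ F) : t < Fintype.card V :=
  depthGE_top_iff.mp (h.top_succ A hA hF)

omit [DecidableEq V] in
/-- Rees' theorem for the quotient by a proper squarefree monomial ideal. -/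
theorem depthGE_iff_le_depthQuotient [Fintype V] {F : UpperSet (Finset V)} (hF : ∅ ∉ F) {t : ℕ} :
    DepthGE K F t ↔ (t : ℕ∞) ≤ depthQuotient (monomialIdeal K F) := by
  have hle : monomialIdeal K F ≤ idealOfVars V K := by
    refine Ideal.span_le.mpr ?_
    rintro _ ⟨a, ha, rfl⟩
    obtain ⟨x, hx⟩ : a.support.Nonempty := by
      rw [Finset.nonempty_iff_ne_empty]; rintro h; exact hF (h ▸ ha)
    have : (X x : MvPolynomial V K) ∣ monomial a 1 := by
      rw [X_dvd_monomial]; right; simpa using hx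
    exact Ideal.mem_of_dvd _ this (Ideal.subset_span ⟨x, rfl⟩)
  have hlt : idealOfVars V K • (⊤ : Submodule (MvPolynomial V K)
      (MvPolynomial V K ⧸ monomialIdeal K F)) < ⊤ := by
    rw [lt_top_iff_ne_top]
    intro h
    have h1 : (1 : MvPolynomial V K ⧸ monomialIdeal K F) ∈
        (idealOfVars V K).map (algebraMap _ (MvPolynomial V K ⧸ monomialIdeal K F)) := by
      rw [← Submodule.restrictScalars_mem (MvPolynomial V K), ← Ideal.smul_top_eq_map, h]
      trivial
    obtain ⟨f, hf, hf1⟩ := (Ideal.mem_map_iff_of_surjective _ Ideal.Quotient.mk_surjective).mp h1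
    have h2 : f - 1 ∈ monomialIdeal K F := Ideal.Quotient.eq.mp (hf1.trans (map_one _).symm)
    have h3 : (1 : MvPolynomial V K) ∈ idealOfVars V K := by
      simpa using sub_mem hf (hle h2)
    have h4 : idealOfVars V K ≤ RingHom.ker (constantCoeff (R := K) (σ := V)) :=
      Ideal.span_le.mpr (by rintro _ ⟨x, rfl⟩; simp)
    simpa using h4 h3
  have : Module.Finite (MvPolynomial V K)
      (ModuleCat.of (MvPolynomial V K) (MvPolynomial V K ⧸ monomialIdeal K F)) :=
    inferInstanceAs (Module.Finite (MvPolynomial V K) (MvPolynomial V K ⧸ monomialIdeal K F))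
  have hsupp : Module.support (MvPolynomial V K) (residueModule V K) =
      PrimeSpectrum.zeroLocus (idealOfVars V K) := by
    rw [Module.support_eq_zeroLocus]
    exact congrArg _ (congrArg _ Ideal.annihilator_quotient)
  have : Module.Finite (MvPolynomial V K) (residueModule V K) :=
    inferInstanceAs (Module.Finite (MvPolynomial V K) (MvPolynomial V K ⧸ idealOfVars V K))
  constructor
  · intro h
    obtain ⟨rs, hlen, hmem, hreg⟩ := ModuleCat.exists_isRegular_of_exists_subsingleton_ext
      (idealOfVars V K) t (ModuleCat.of (MvPolynomial V K) (MvPolynomial V K ⧸ monomialIdeal K F))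
      hlt (residueModule V K) hsupp h
    rw [← hlen]
    exact le_iSup₂ (f := fun (rs : List (MvPolynomial V K)) _ => (rs.length : ℕ∞)) rs ⟨hreg, hmem⟩
  · intro h i hi
    have h' : (i : ℕ∞) < depthQuotient (monomialIdeal K F) :=
      lt_of_lt_of_le (by exact_mod_cast hi) h
    obtain ⟨rs, h'⟩ := lt_iSup_iff.mp h'
    obtain ⟨⟨hreg, hmem⟩, h'⟩ := lt_iSup_iff.mp h'
    exact ModuleCat.subsingleton_ext_of_exists_isRegular (idealOfVars V K) (residueModule V K)
      hsupp.subset (ModuleCat.of (MvPolynomial V K) (MvPolynomial V K ⧸ monomialIdeal K F)) hlt rs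
      hmem hreg i (by exact_mod_cast h')

end

/-! ### Matchings inside a vertex set -/

section

variable {V : Type u} [DecidableEq V] {G : SimpleGraph V}

/-- The vertex set `A` contains the vertices of a `k`-matching of `G`. -/
def HasMatching (G : SimpleGraph V) : ℕ → Finset V → Prop
  | 0, _ => True
  | k + 1, A => ∃ i ∈ A, ∃ j ∈ A, G.Adj i j ∧ HasMatching G k ((A.erase i).erase j)

theorem HasMatching.mono {k : ℕ} : ∀ {A B : Finset V}, HasMatching G k A → A ⊆ B →
    HasMatching G k B := by
  induction k with
  | zero => intros; trivial
  | succ k ih =>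
    rintro A B ⟨i, hi, j, hj, hij, h⟩ hAB
    exact ⟨i, hAB hi, j, hAB hj, hij, ih h
      (Finset.erase_subset_erase _ (Finset.erase_subset_erase _ hAB))⟩

theorem HasMatching.insert_edge {k : ℕ} {A : Finset V} (h : HasMatching G k A) {i j : V}
    (hij : G.Adj i j) (hi : i ∉ A) (hj : j ∉ A) :
    HasMatching G (k + 1) (insert i (insert j A)) :=
  ⟨i, by simp, j, by simp, hij, h.mono (by intro v hv; grind)⟩

/-- A matching either avoids the vertex `j` or matches it with one of its neighbours. -/
theorem HasMatching.erase_or {k : ℕ} (j : V) : ∀ {A : Finset V}, HasMatching G (k + 1) A →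
    HasMatching G (k + 1) (A.erase j) ∨
      ∃ a ∈ A, G.Adj j a ∧ HasMatching G k ((A.erase j).erase a) := by
  induction k with
  | zero =>
    rintro A ⟨p, hp, q, hq, hpq, -⟩
    by_cases hpj : p = j
    · exact Or.inr ⟨q, hq, hpj ▸ hpq, trivial⟩
    by_cases hqj : q = j
    · exact Or.inr ⟨p, hp, hqj ▸ hpq.symm, trivial⟩
    · exact Or.inl ⟨p, by simp [hp, hpj], q, by simp [hq, hqj], hpq, trivial⟩
  | succ k ih =>
    rintro A ⟨p, hp, q, hq, hpq, h⟩
    by_cases hpj : p = j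
    · exact Or.inr ⟨q, hq, hpj ▸ hpq, hpj ▸ h⟩
    by_cases hqj : q = j
    · exact Or.inr ⟨p, hp, hqj ▸ hpq.symm, by rwa [Finset.erase_right_comm, ← hqj]⟩
    rcases ih h with h | ⟨a, ha, hja, h⟩
    · refine Or.inl ⟨p, by simp [hp, hpj], q, by simp [hq, hqj], hpq, h.mono ?_⟩
      intro v hv; grind
    · refine Or.inr ⟨a, by grind, hja, p, by grind, q, by grind, hpq, h.mono ?_⟩
      intro v hv; grind

theorem HasMatching.erase {k : ℕ} (v : V) {A : Finset V} (h : HasMatching G (k + 1) A) :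
    HasMatching G k (A.erase v) := by
  induction k generalizing A with
  | zero => trivial
  | succ k ih =>
    obtain ⟨p, hp, q, hq, hpq, h⟩ := h
    by_cases hpv : p = v
    · exact h.mono (by intro w hw; grind)
    by_cases hqv : q = v
    · exact h.mono (by intro w hw; grind)
    refine ⟨p, by grind, q, by grind, hpq, (ih h).mono ?_⟩
    intro w hw; grind

theorem HasMatching.of_succ {k : ℕ} {A : Finset V} (h : HasMatching G (k + 1) A) :
    HasMatching G k A := by
  obtain ⟨p, hp, q, hq, hpq, h⟩ := h
  exact h.mono (by intro w hw; grind)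

theorem HasMatching.of_le {k m : ℕ} (hmk : m ≤ k) {A : Finset V} (h : HasMatching G k A) :
    HasMatching G m A := by
  induction k, hmk using Nat.le_induction with
  | base => exact h
  | succ k _ ih => exact ih h.of_succ

/-- Isolated vertices play no role in a matching. -/
theorem hasMatching_erase_iff {k : ℕ} {A : Finset V} {i : V} (hi : ∀ v ∈ A, ¬ G.Adj i v) :
    HasMatching G k (A.erase i) ↔ HasMatching G k A := by
  refine ⟨fun h => h.mono (Finset.erase_subset _ _), fun h => ?_⟩
  cases k with
  | zero => trivial
  | succ k =>
    rcases h.erase_or i with h | ⟨a, ha, hia, -⟩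
    · exact h
    · exact absurd hia (hi a ha)

/-- A leaf edge can be assumed to lie in a matching. -/
theorem hasMatching_insert_edge_iff {k : ℕ} {X : Finset V} {i j : V} (hij : G.Adj i j)
    (hi : i ∉ X) (hj : j ∉ X) (h : (∀ v ∈ X, ¬ G.Adj i v) ∨ (∀ v ∈ X, ¬ G.Adj j v)) :
    HasMatching G (k + 1) (insert i (insert j X)) ↔ HasMatching G k X := by
  refine ⟨fun hM => ?_, fun hM => hM.insert_edge hij hi hj⟩
  have key : ∀ {i j : V}, G.Adj i j → i ∉ X → j ∉ X → (∀ v ∈ X, ¬ G.Adj i v) →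
      HasMatching G (k + 1) (insert i (insert j X)) → HasMatching G k X := by
    intro i j hij hi hj h hM
    rcases hM.erase_or i with h' | ⟨a, ha, hia, h'⟩
    · refine (h'.erase j).mono ?_
      intro v hv; grind
    · have : a = j := by
        by_contra hne
        have : a ≠ i := hia.ne'
        exact h a (by grind) hia
      subst this
      exact h'.mono (by intro v hv; grind)
  rcases h with h | h
  · exact key hij hi hj h hM
  · exact key hij.symm hj hi h (by rwa [Finset.insert_comm])

theorem hasMatching_iff [Fintype V] {k : ℕ} : ∀ {A : Finset V}, HasMatching G k A ↔
    ∃ M, IsKMatching G k M ∧ matchedVertices M ⊆ A := by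
  induction k with
  | zero =>
    intro A
    exact ⟨fun _ => ⟨∅, ⟨by simp, by simp, by simp⟩, by simp [matchedVertices]⟩, fun _ => trivial⟩
  | succ k ih =>
    intro A
    constructor
    · rintro ⟨i, hi, j, hj, hij, h⟩
      obtain ⟨M, hM, hMA⟩ := ih.mp h
      refine ⟨insert s(i, j) M, ?_, ?_⟩
      · convert hM.insert hij (fun h => by grind) (fun h => by grind)
      · have := matchedVertices_insert M i j
        intro v hv
        rw [mem_matchedVertices] at hv
        obtain ⟨e, he, hv⟩ := hv
        rcases Finset.mem_insert.mp he with rfl | he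
        · rcases Sym2.mem_iff.mp hv with rfl | rfl <;> assumption
        · have := hMA ((mem_matchedVertices M v).mpr ⟨e, he, hv⟩)
          grind
    · rintro ⟨M, hM, hMA⟩
      obtain ⟨i, j, N, hij, hN, hi, hj, rfl⟩ := hM.exists_insert
      have hi' : i ∈ matchedVertices (insert s(i, j) N) :=
        (mem_matchedVertices _ _).mpr ⟨_, Finset.mem_insert_self _ _, Sym2.mem_mk_left _ _⟩
      have hj' : j ∈ matchedVertices (insert s(i, j) N) :=
        (mem_matchedVertices _ _).mpr ⟨_, Finset.mem_insert_self _ _, Sym2.mem_mk_right _ _⟩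
      refine ⟨i, hMA hi', j, hMA hj', hij, ih.mpr ⟨N, hN, fun v hv => ?_⟩⟩
      have : v ∈ matchedVertices (insert s(i, j) N) := by
        obtain ⟨e, he, hv⟩ := (mem_matchedVertices _ _).mp hv
        exact (mem_matchedVertices _ _).mpr ⟨e, Finset.mem_insert_of_mem he, hv⟩
      have := hMA this
      grind

/-- The family of the squarefree power `I(G[W])^{[k]}`, where `G[W]` is the induced subgraph. -/
def matchingFamily (G : SimpleGraph V) (W : Finset V) (k : ℕ) : UpperSet (Finset V) :=
  ⟨{A | HasMatching G k (A ∩ W)}, fun _ _ h hA => hA.mono (Finset.inter_subset_inter_right h)⟩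

/-- The family of the colon ideal `I(G[W ∪ {j}])^{[k]} : x_j`, for `j ∉ W`. -/
def colonFamily (G : SimpleGraph V) (j : V) (W : Finset V) (k : ℕ) : UpperSet (Finset V) :=
  ⟨{A | HasMatching G k (insert j (A ∩ W))}, fun _ _ h hA =>
    hA.mono (Finset.insert_subset_insert _ (Finset.inter_subset_inter_right h))⟩

theorem mem_matchingFamily {W : Finset V} {k : ℕ} {A : Finset V} :
    A ∈ matchingFamily G W k ↔ HasMatching G k (A ∩ W) := Iff.rfl

theorem mem_colonFamily {j : V} {W : Finset V} {k : ℕ} {A : Finset V} :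
    A ∈ colonFamily G j W k ↔ HasMatching G k (insert j (A ∩ W)) := Iff.rfl

theorem restrict_matchingFamily (W : Finset V) (k : ℕ) (x : V) :
    restrict (matchingFamily G W k) x = matchingFamily G (W.erase x) k := by
  ext A
  have : A.erase x ∩ W = A ∩ W.erase x := by ext; grind
  simp [mem_matchingFamily, this]

theorem restrict_colonFamily (j : V) (W : Finset V) (k : ℕ) (x : V) :
    restrict (colonFamily G j W k) x = colonFamily G j (W.erase x) k := by
  ext A
  have : A.erase x ∩ W = A ∩ W.erase x := by ext; grind
  simp [mem_colonFamily, this]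

theorem colon_matchingFamily (W : Finset V) (k : ℕ) (j : V) :
    colon (matchingFamily G (insert j W) k) j = colonFamily G j W k := by
  ext A
  simp only [SetLike.mem_coe, mem_colon, mem_matchingFamily, mem_colonFamily]
  rw [← Finset.insert_inter_distrib]

/-- Dividing by both ends of a leaf edge lowers the size of the matchings by one. -/
theorem colon_colonFamily {W : Finset V} {i j : V} (k : ℕ) (hij : G.Adj i j) (hi : i ∉ W)
    (hj : j ∉ W) (h : (∀ v ∈ W, ¬ G.Adj i v) ∨ (∀ v ∈ W, ¬ G.Adj j v)) :
    colon (colonFamily G j (insert i W) (k + 1)) i = matchingFamily G W k := by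
  ext A
  simp only [SetLike.mem_coe, mem_colon, mem_colonFamily, mem_matchingFamily]
  rw [← Finset.insert_inter_distrib, Finset.insert_comm]
  exact hasMatching_insert_edge_iff hij (by simp [hi]) (by simp [hj])
    (h.imp (fun h v hv => h v (Finset.mem_of_mem_inter_right hv))
      fun h v hv => h v (Finset.mem_of_mem_inter_right hv))

theorem colonFamily_eq {W : Finset V} {j : V} (k : ℕ) (hj : j ∉ W) (h : ∀ v ∈ W, ¬ G.Adj j v) :
    colonFamily G j W k = matchingFamily G W k := by
  ext A
  simp only [SetLike.mem_coe, mem_colonFamily, mem_matchingFamily]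
  rw [← hasMatching_erase_iff (i := j), Finset.erase_insert (by simp [hj])]
  intro v hv
  rcases Finset.mem_insert.mp hv with rfl | hv
  · exact G.loopless.irrefl _
  · exact h v (Finset.mem_of_mem_inter_right hv)

theorem matchingFamily_union {W L : Finset V} (k : ℕ)
    (h : ∀ i ∈ L, ∀ v ∈ W ∪ L, ¬ G.Adj i v) :
    matchingFamily G (W ∪ L) k = matchingFamily G W k := by
  induction L using Finset.induction_on with
  | empty => simp
  | insert i L hi ih =>
    by_cases hiW : i ∈ W
    · have : W ∪ insert i L = W ∪ L := by grind
      rw [this, ih (by grind)]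
    have e : (W ∪ insert i L).erase i = W ∪ L := by grind
    rw [← ih (by grind)]
    ext A
    simp only [SetLike.mem_coe, mem_matchingFamily]
    rw [← hasMatching_erase_iff (i := i)]
    · rw [← Finset.inter_erase, e]
    · intro v hv
      exact h i (by simp) v (Finset.mem_of_mem_inter_right hv)

theorem monomialIdeal_matchingFamily [Fintype V] (K : Type v) [Field K] (G : SimpleGraph V)
    (k : ℕ) : monomialIdeal K (matchingFamily G Finset.univ k) = matchingIdeal K G k := by
  refine le_antisymm (Ideal.span_le.mpr ?_) (Ideal.span_le.mpr ?_)
  · rintro _ ⟨a, ha, rfl⟩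
    obtain ⟨M, hM, hMA⟩ := hasMatching_iff.mp ha
    have h1 : (monomial (expOf (matchedVertices M)) 1 : MvPolynomial V K) ∈ matchingIdeal K G k :=
      Ideal.subset_span ⟨M, hM, (prod_X_eq _).symm⟩
    refine Ideal.mem_of_dvd _ (monomial_dvd_monomial.mpr ⟨Or.inr fun v => ?_, dvd_rfl⟩) h1
    rw [expOf_apply]
    split_ifs with hv
    · have := hMA hv
      rw [Finset.inter_univ, Finsupp.mem_support_iff] at this
      omega
    · exact Nat.zero_le _
  · rintro _ ⟨M, hM, rfl⟩
    rw [prod_X_eq]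
    refine Ideal.subset_span ⟨_, ?_, rfl⟩
    refine hasMatching_iff.mpr ⟨M, hM, fun v hv => ?_⟩
    simp [expOf_apply, hv]

end

/-! ### Stars in a forest and their effect on the depth -/

section

variable {V : Type u} {G : SimpleGraph V}

/-- The first vertex of a longest path in a finite forest has degree at most one. -/
theorem exists_forall_adj_eq [Finite V] [Nonempty V] (hG : G.IsAcyclic) :
    ∃ v : V, ∀ a b, G.Adj v a → G.Adj v b → a = b := by
  obtain ⟨u, v, p, hp, hmax⟩ := SimpleGraph.Walk.exists_isPath_forall_isPath_length_le_length G
  refine ⟨u, fun a b ha hb => ?_⟩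
  have key : ∀ a, G.Adj u a → a = p.snd := by
    intro a ha
    refine hG.eq_snd_of_adj_start hp ha ?_
    by_contra hna
    have := hmax _ _ _ (hp.cons (h := ha.symm) hna)
    simp at this
  rw [key a ha, key b hb]

theorem exists_mem_forall_adj_eq (hG : G.IsAcyclic) {A : Finset V} (hA : A.Nonempty) :
    ∃ v ∈ A, ∀ a ∈ A, ∀ b ∈ A, G.Adj v a → G.Adj v b → a = b := by
  have : Nonempty (A : Set V) := hA.to_subtype
  have : Finite (A : Set V) := A.finite_toSet
  obtain ⟨v, hv⟩ := exists_forall_adj_eq (hG.induce (A : Set V))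
  exact ⟨v, v.2, fun a ha b hb hva hvb =>
    congrArg Subtype.val (hv ⟨a, ha⟩ ⟨b, hb⟩ hva hvb)⟩

variable [DecidableEq V]

/-- A vertex `j` of `G[U]` all of whose neighbours, except at most one, are leaves: `L` is the
nonempty set of leaves at `j`, and `W` is the set of the remaining vertices of `U`, among which
`j` has at most one neighbour. -/
structure LeafStar (G : SimpleGraph V) (U : Finset V) (j : V) (L W : Finset V) : Prop where
  eq_insert : U = insert j (W ∪ L)
  notMem : j ∉ W ∪ L
  disjoint : Disjoint W L
  nonempty : L.Nonempty
  adj : ∀ i ∈ L, G.Adj i j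
  leaf : ∀ i ∈ L, ∀ v ∈ W ∪ L, ¬ G.Adj i v
  unique : ∀ a ∈ W, ∀ b ∈ W, G.Adj j a → G.Adj j b → a = b

/-- In a forest with an edge some vertex has a leaf among its neighbours and at most one neighbour
that is not a leaf. -/
theorem exists_leafStar (hG : G.IsAcyclic) {U : Finset V} (hU : HasMatching G 1 U) :
    ∃ j L W, LeafStar G U j L W := by
  classical
  -- the vertices of degree at least two
  set U₁ := U.filter fun v => ∃ a ∈ U, ∃ b ∈ U, G.Adj v a ∧ G.Adj v b ∧ a ≠ b with hU₁
  have deg : ∀ v ∈ U, v ∉ U₁ → ∀ a ∈ U, ∀ b ∈ U, G.Adj v a → G.Adj v b → a = b := by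
    intro v hv hv1 a ha b hb hva hvb
    by_contra hab
    exact hv1 (Finset.mem_filter.mpr ⟨hv, a, ha, b, hb, hva, hvb, hab⟩)
  -- it suffices that `j` has a leaf and at most one neighbour of degree at least two
  suffices h : ∃ j ∈ U, (∃ i ∈ U, i ∉ U₁ ∧ G.Adj i j) ∧
      ∀ a ∈ U₁, ∀ b ∈ U₁, G.Adj j a → G.Adj j b → a = b by
    obtain ⟨j, hj, ⟨i, hi, hi1, hij⟩, huniq⟩ := h
    set L := U.filter fun i => i ∉ U₁ ∧ G.Adj i j with hL
    have hLU : L ⊆ U := Finset.filter_subset _ _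
    have hjL : j ∉ L := fun h => G.loopless.irrefl _ (Finset.mem_filter.mp h).2.2
    refine ⟨j, L, (U.erase j) \ L, ?_, ?_, Finset.sdiff_disjoint, ⟨i, ?_⟩, ?_, ?_, ?_⟩
    · ext v; grind
    · grind
    · simp [hL, hi, hi1, hij]
    · intro i hi; exact (Finset.mem_filter.mp hi).2.2
    · intro i hi v hv hiv
      obtain ⟨hiU, hi1, hij⟩ := Finset.mem_filter.mp hi
      have hvU : v ∈ U := by grind
      have hvj : v ≠ j := by grind
      exact hvj (deg i hiU hi1 v hvU j hj hiv hij)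
    · intro a ha b hb hja hjb
      have mem : ∀ a ∈ (U.erase j) \ L, G.Adj j a → a ∈ U₁ := by
        intro a ha hja
        by_contra h
        rw [Finset.mem_sdiff] at ha
        exact ha.2 (Finset.mem_filter.mpr ⟨Finset.mem_of_mem_erase ha.1, h, hja.symm⟩)
      exact huniq a (mem a ha hja) b (mem b hb hjb) hja hjb
  by_cases hne : U₁.Nonempty
  · obtain ⟨j, hj, huniq⟩ := exists_mem_forall_adj_eq hG hne
    obtain ⟨hjU, a, ha, b, hb, hja, hjb, hab⟩ := Finset.mem_filter.mp hj
    refine ⟨j, hjU, ?_, huniq⟩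
    by_cases ha1 : a ∈ U₁
    · refine ⟨b, hb, fun hb1 => hab (huniq a ha1 b hb1 hja hjb), hjb.symm⟩
    · exact ⟨a, ha, ha1, hja.symm⟩
  · obtain ⟨i, hi, j, hj, hij, -⟩ := hU
    rw [Finset.not_nonempty_iff_eq_empty] at hne
    exact ⟨j, hj, ⟨i, hi, by simp [hne], hij⟩, by simp [hne]⟩

theorem LeafStar.forall_or_exists {U : Finset V} {j : V} {L W : Finset V}
    (h : LeafStar G U j L W) : (∀ v ∈ W, ¬ G.Adj j v) ∨
      ∃ b ∈ W, G.Adj j b ∧ ∀ v ∈ W.erase b, ¬ G.Adj j v := by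
  by_contra! hcon
  obtain ⟨⟨b, hb, hjb⟩, h2⟩ := hcon
  obtain ⟨v, hv, hjv⟩ := h2 b hb hjb
  exact Finset.ne_of_mem_erase hv (h.unique v (Finset.mem_of_mem_erase hv) b hb hjv hjb)

section Bounds

variable {K : Type v} [Field K]

theorem depthGE_matchingFamily_zero (W : Finset V) (t : ℕ) :
    DepthGE K (matchingFamily G W 0) t :=
  .of_empty_mem (F := matchingFamily G W 0) (mem_matchingFamily.mpr trivial) t

theorem matchingFamily_eq_top {W : Finset V} {k : ℕ} (h : ¬ HasMatching G k W) :
    matchingFamily G W k = ⊤ := by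
  ext A
  simp only [SetLike.mem_coe, mem_matchingFamily, UpperSet.notMem_top, iff_false]
  exact fun hA => h (hA.mono Finset.inter_subset_right)

theorem colonFamily_eq_top {j : V} {W : Finset V} {k : ℕ} (h : ¬ HasMatching G k (insert j W)) :
    colonFamily G j W k = ⊤ := by
  ext A
  simp only [SetLike.mem_coe, mem_colonFamily, UpperSet.notMem_top, iff_false]
  exact fun hA => h (hA.mono (Finset.insert_subset_insert _ Finset.inter_subset_right))

theorem not_hasMatching_singleton (j : V) (k : ℕ) : ¬ HasMatching G (k + 1) {j} := by
  rintro ⟨p, hp, q, hq, hpq, -⟩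
  rw [Finset.mem_singleton] at hp hq
  exact hpq.ne (hp.trans hq.symm)

theorem not_hasMatching_empty (k : ℕ) : ¬ HasMatching G (k + 1) ∅ := by
  rintro ⟨p, hp, -⟩
  simp at hp

theorem DepthGE.matchingFamily_erase {W : Finset V} {k t : ℕ}
    (h : DepthGE K (matchingFamily G W k) t) (b : V) :
    DepthGE K (matchingFamily G (W.erase b) k) t := by
  rw [← restrict_matchingFamily]
  exact h.restrict b

/-- The lower bound for the depth at a star with leaves `L` and centre `j`, after division by
`x_j`. -/
theorem depthGE_colonFamily_union {j : V} {W : Finset V} (k : ℕ) (L : Finset V) :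
    j ∉ W ∪ L → Disjoint W L → (∀ i ∈ L, G.Adj i j) → (∀ i ∈ L, ∀ v ∈ W ∪ L, ¬ G.Adj i v) → ∀ t,
      DepthGE K (matchingFamily G W k) (t + L.card - 1) →
      DepthGE K (colonFamily G j W (k + 1)) (t + L.card) →
      DepthGE K (colonFamily G j (W ∪ L) (k + 1)) t := by
  induction L using Finset.induction_on with
  | empty => intro _ _ _ _ t _ h; simpa using h
  | insert i L hi ih =>
    intro hj hd hadj hleaf t h1 h2
    rw [Finset.card_insert_of_notMem hi] at h1 h2
    have hiWL : i ∉ W ∪ L := by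
      have := Finset.disjoint_right.mp hd (Finset.mem_insert_self i L)
      grind
    have e : W ∪ insert i L = insert i (W ∪ L) := by grind
    have hleaf' : ∀ i ∈ L, ∀ v ∈ W ∪ L, ¬ G.Adj i v := fun i hi v hv =>
      hleaf i (by grind) v (by grind)
    rw [e]
    refine DepthGE.of_colon_of_restrict i ?_ ?_
    · rw [colon_colonFamily k (hadj i (by simp)) hiWL (by grind)
        (Or.inl fun v hv => hleaf i (by simp) v (by grind)), matchingFamily_union k hleaf']
      exact h1.mono (by omega)
    · rw [restrict_colonFamily, Finset.erase_insert hiWL]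
      refine ih (by grind) (hd.mono_right (Finset.subset_insert _ _))
        (fun i hi => hadj i (by grind)) hleaf' (t + 1) (h1.mono (by omega)) (h2.mono (by omega))

/-- Removing a leaf `i` at `j` strictly increases the depth, after division by `x_j`. The
variables of the leaves at `j`, then that of its last neighbour, then all others in any order are
used one by one for `DepthGE.restrict_succ`. -/
theorem DepthGE.colonFamily_erase_leaf [Fintype V] {i j : V} (hij : G.Adj i j) (k : ℕ)
    (W : Finset V) : i ∉ W → j ∉ W → (∀ v ∈ W, ¬ G.Adj i v) →
      (∀ a ∈ W, ∀ b ∈ W, G.Adj j a → G.Adj j b → a ≠ b →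
        (∀ v ∈ W, ¬ G.Adj a v) ∨ (∀ v ∈ W, ¬ G.Adj b v)) →
      HasMatching G k W → ∀ t, DepthGE K (colonFamily G j (insert i W) (k + 1)) t →
      DepthGE K (colonFamily G j W (k + 1)) (t + 1) := by
  induction W using Finset.strongInduction with
  | H W ih =>
  intro hi hj hleaf hW hM t h
  have htop : DepthGE K (⊤ : UpperSet (Finset V)) (t + 1) := by
    refine h.top_succ (insert i W) ?_ ?_
    · rw [mem_colonFamily, Finset.inter_self, Finset.insert_comm]
      exact hM.insert_edge hij hi hj
    · rw [mem_colonFamily, Finset.empty_inter]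
      exact not_hasMatching_singleton j k
  rcases W.eq_empty_or_nonempty with rfl | hne
  · rw [colonFamily_eq_top (not_hasMatching_singleton j k)]
    exact htop
  -- a variable `y` that divides out of the restriction into the colon ideal
  obtain ⟨y, hyW, hy⟩ : ∃ y ∈ W, ∀ X ⊆ W, HasMatching G (k + 1) (insert j (insert y X)) →
      HasMatching G k X := by
    have edge : ∀ y ∈ W, G.Adj j y → ((∀ v ∈ W, ¬ G.Adj y v) ∨
        (∀ v ∈ W.erase y, ¬ G.Adj j v)) → ∀ X ⊆ W,
          HasMatching G (k + 1) (insert j (insert y X)) → HasMatching G k X := by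
      intro y hy hjy hor X hX hXM
      have e : insert j (insert y X) = insert y (insert j (X.erase y)) := by
        ext; grind
      rw [e, hasMatching_insert_edge_iff hjy.symm (by simp) (by grind)
        (hor.imp (by grind) (by grind))] at hXM
      exact hXM.mono (Finset.erase_subset _ _)
    by_cases h1 : ∃ y ∈ W, G.Adj j y ∧ ∀ v ∈ W, ¬ G.Adj y v
    · obtain ⟨y, hy, hjy, hyl⟩ := h1
      exact ⟨y, hy, edge y hy hjy (Or.inl hyl)⟩
    by_cases h2 : ∃ y ∈ W, G.Adj j y
    · obtain ⟨y, hy, hjy⟩ := h2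
      refine ⟨y, hy, edge y hy hjy (Or.inr fun v hv hjv => ?_)⟩
      rcases hW v (Finset.mem_of_mem_erase hv) y hy hjv hjy (Finset.ne_of_mem_erase hv) with h | h
      · exact h1 ⟨v, Finset.mem_of_mem_erase hv, hjv, h⟩
      · exact h1 ⟨y, hy, hjy, h⟩
    · push Not at h2
      obtain ⟨y, hy⟩ := hne
      refine ⟨y, hy, fun X hX hXM => ?_⟩
      have hXM' : HasMatching G (k + 1) ((insert j (insert y X)).erase j) := by
        rw [hasMatching_erase_iff]
        · exact hXM
        · intro v hv
          rcases Finset.mem_insert.mp hv with rfl | hv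
          · exact G.loopless.irrefl _
          · exact h2 v (by grind)
      exact (hXM'.erase y).mono (by intro v hv; grind)
  have er : SquarefreePowers.restrict (colonFamily G j (insert i W) (k + 1)) i =
      colonFamily G j W (k + 1) := by
    rw [restrict_colonFamily, Finset.erase_insert hi]
  rw [← er]
  refine h.restrict_succ i y ?_ ?_
  · intro A hA
    have e1 : (insert y A).erase i ∩ insert i W = insert y (A ∩ W) := by
      ext; grind
    have e2 : insert j (insert i A ∩ insert i W) = insert i (insert j (A ∩ W)) := by
      ext; grind
    rw [mem_colonFamily, e1] at hA
    rw [mem_colonFamily, e2]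
    exact (hy _ Finset.inter_subset_right hA).insert_edge hij (by simp [hi]) (by simp [hj])
  · rw [er, restrict_colonFamily]
    by_cases hM' : HasMatching G k (W.erase y)
    · refine ih _ (Finset.erase_ssubset hyW) (by simp [hi]) (by simp [hj])
        (fun v hv => hleaf v (Finset.mem_of_mem_erase hv)) ?_ hM' t ?_
      · intro a ha b hb hja hjb hab
        refine (hW a (Finset.mem_of_mem_erase ha) b (Finset.mem_of_mem_erase hb) hja hjb hab).imp
          ?_ ?_ <;> exact fun h v hv => h v (Finset.mem_of_mem_erase hv)
      · have := h.restrict y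
        rwa [restrict_colonFamily, Finset.erase_insert_of_ne (by rintro rfl; exact hi hyW)] at this
    · rw [colonFamily_eq_top]
      · exact htop
      · intro hcon
        refine hM' ((hcon.erase j).mono ?_)
        intro v hv; grind

/-- The upper bounds for the depth at a star with leaves `L` and centre `j`, after division by
`x_j`. -/
theorem DepthGE.of_colonFamily_union [Fintype V] {j : V} {W : Finset V} {k : ℕ}
    (hM : HasMatching G k W)
    (hunique : ∀ a ∈ W, ∀ b ∈ W, G.Adj j a → G.Adj j b → a = b) (L : Finset V) :
    j ∉ W ∪ L → Disjoint W L → (∀ i ∈ L, G.Adj i j) → (∀ i ∈ L, ∀ v ∈ W ∪ L, ¬ G.Adj i v) → ∀ t,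
      DepthGE K (colonFamily G j (W ∪ L) (k + 1)) t →
      DepthGE K (colonFamily G j W (k + 1)) (t + L.card) ∧
        (L.Nonempty → DepthGE K (matchingFamily G W k) (t + L.card - 1)) := by
  induction L using Finset.induction_on with
  | empty => intro _ _ _ _ t h; simpa using h
  | insert i L hi ih =>
    intro hj hd hadj hleaf t h
    rw [Finset.card_insert_of_notMem hi]
    have hiWL : i ∉ W ∪ L := by
      have := Finset.disjoint_right.mp hd (Finset.mem_insert_self i L)
      grind
    have e : W ∪ insert i L = insert i (W ∪ L) := by grind
    have hleaf' : ∀ i ∈ L, ∀ v ∈ W ∪ L, ¬ G.Adj i v := fun i hi v hv =>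
      hleaf i (by grind) v (by grind)
    have hleafi : ∀ v ∈ W ∪ L, ¬ G.Adj i v := fun v hv => hleaf i (by simp) v (by grind)
    have hjWL : j ∉ W ∪ L := by grind
    rw [e] at h
    have h1 := DepthGE.colonFamily_erase_leaf (hadj i (by simp)) k (W ∪ L) hiWL hjWL hleafi (by
      intro a ha b hb hja hjb hab
      rcases Finset.mem_union.mp ha with haW | haL
      · rcases Finset.mem_union.mp hb with hbW | hbL
        · exact absurd (hunique a haW b hbW hja hjb) hab
        · exact Or.inr (hleaf' b hbL)
      · exact Or.inl (hleaf' a haL)) (hM.mono Finset.subset_union_left) t h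
    obtain ⟨h2, h3⟩ := ih hjWL (hd.mono_right (Finset.subset_insert _ _))
      (fun i hi => hadj i (by grind)) hleaf' (t + 1) h1
    refine ⟨h2.mono (by omega), fun _ => ?_⟩
    rcases L.eq_empty_or_nonempty with rfl | hL
    · have := h.colon i
      rw [colon_colonFamily k (hadj i (by simp)) hiWL hjWL (Or.inl hleafi),
        matchingFamily_union k hleaf'] at this
      simpa using this
    · exact (h3 hL).mono (by omega)

end Bounds

end

/-! ### Squarefree powers of a forest -/

section

variable {V : Type u} {G : SimpleGraph V}

open Classical in
/-- The vertices of `U` that are not isolated in the induced subgraph `G[U]`. -/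
noncomputable def nonisolated (G : SimpleGraph V) (U : Finset V) : Finset V :=
  U.filter fun v => ∃ a ∈ U, G.Adj v a

theorem mem_nonisolated {U : Finset V} {v : V} :
    v ∈ nonisolated G U ↔ v ∈ U ∧ ∃ a ∈ U, G.Adj v a := by
  simp [nonisolated]

theorem nonisolated_subset (U : Finset V) : nonisolated G U ⊆ U := fun _ hv =>
  (mem_nonisolated.mp hv).1

theorem nonisolated_mono {U W : Finset V} (h : W ⊆ U) : nonisolated G W ⊆ nonisolated G U := by
  intro v hv
  obtain ⟨hv, a, ha, hva⟩ := mem_nonisolated.mp hv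
  exact mem_nonisolated.mpr ⟨h hv, a, h ha, hva⟩

variable [DecidableEq V]

theorem HasMatching.two_mul_le_card {k : ℕ} : ∀ {U : Finset V}, HasMatching G k U →
    2 * k ≤ (nonisolated G U).card := by
  induction k with
  | zero => simp
  | succ k ih =>
    rintro U ⟨i, hi, j, hj, hij, h⟩
    have h1 := ih h
    have hsub : insert i (insert j (nonisolated G ((U.erase i).erase j))) ⊆ nonisolated G U := by
      intro v hv
      rcases Finset.mem_insert.mp hv with rfl | hv
      · exact mem_nonisolated.mpr ⟨hi, j, hj, hij⟩
      rcases Finset.mem_insert.mp hv with rfl | hv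
      · exact mem_nonisolated.mpr ⟨hj, i, hi, hij.symm⟩
      · exact nonisolated_mono (by intro w hw; grind) hv
    have hsub' := nonisolated_subset (G := G) ((U.erase i).erase j)
    have hj' : j ∉ nonisolated G ((U.erase i).erase j) := fun h => by
      have := hsub' h; grind
    have hi' : i ∉ insert j (nonisolated G ((U.erase i).erase j)) := fun h => by
      rcases Finset.mem_insert.mp h with h | h
      · exact hij.ne h
      · have := hsub' h; grind
    have := Finset.card_le_card hsub
    rw [Finset.card_insert_of_notMem hi', Finset.card_insert_of_notMem hj'] at this
    omega

namespace LeafStar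

variable {K : Type v} [Field K] {U L W : Finset V} {j b : V}

theorem card_nonisolated_le (s : LeafStar G U j L W) :
    (nonisolated G W).card + L.card + 1 ≤ (nonisolated G U).card := by
  have hU : U = insert j (W ∪ L) := s.eq_insert
  obtain ⟨i, hi⟩ := s.nonempty
  have hsub : insert j (nonisolated G W ∪ L) ⊆ nonisolated G U := by
    intro v hv
    rcases Finset.mem_insert.mp hv with rfl | hv
    · exact mem_nonisolated.mpr ⟨by grind, i, by grind, (s.adj i hi).symm⟩
    rcases Finset.mem_union.mp hv with hv | hv
    · exact nonisolated_mono (by grind) hv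
    · exact mem_nonisolated.mpr ⟨by grind, j, by grind, s.adj v hv⟩
  have hjn : j ∉ nonisolated G W ∪ L := fun h =>
    s.notMem (Finset.union_subset_union_left (nonisolated_subset W) h)
  have hd : Disjoint (nonisolated G W) L := s.disjoint.mono_left (nonisolated_subset W)
  have := Finset.card_le_card hsub
  rwa [Finset.card_insert_of_notMem hjn, Finset.card_union_of_disjoint hd] at this

theorem card_nonisolated_erase_le (s : LeafStar G U j L W) (hb : b ∈ W) (hjb : G.Adj j b) :
    (nonisolated G (W.erase b)).card + L.card + 2 ≤ (nonisolated G U).card := by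
  have hU : U = insert j (W ∪ L) := s.eq_insert
  obtain ⟨i, hi⟩ := s.nonempty
  have hdisj := s.disjoint
  have hsub : insert b (insert j (nonisolated G (W.erase b) ∪ L)) ⊆ nonisolated G U := by
    intro v hv
    rcases Finset.mem_insert.mp hv with rfl | hv
    · exact mem_nonisolated.mpr ⟨by grind, j, by grind, hjb.symm⟩
    rcases Finset.mem_insert.mp hv with rfl | hv
    · exact mem_nonisolated.mpr ⟨by grind, i, by grind, (s.adj i hi).symm⟩
    rcases Finset.mem_union.mp hv with hv | hv
    · exact nonisolated_mono (by grind) hv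
    · exact mem_nonisolated.mpr ⟨by grind, j, by grind, s.adj v hv⟩
  have hWb := nonisolated_subset (G := G) (W.erase b)
  have hd : Disjoint (nonisolated G (W.erase b)) L :=
    s.disjoint.mono_left (hWb.trans (Finset.erase_subset b W))
  have hjn : j ∉ nonisolated G (W.erase b) ∪ L := fun h =>
    s.notMem (Finset.union_subset_union_left (hWb.trans (Finset.erase_subset b W)) h)
  have hbn : b ∉ insert j (nonisolated G (W.erase b) ∪ L) := by
    intro h
    rcases Finset.mem_insert.mp h with h | h
    · exact hjb.ne h.symm
    rcases Finset.mem_union.mp h with h | h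
    · exact Finset.notMem_erase b W (hWb h)
    · exact Finset.disjoint_left.mp hdisj hb h
  have := Finset.card_le_card hsub
  rw [Finset.card_insert_of_notMem hbn, Finset.card_insert_of_notMem hjn,
    Finset.card_union_of_disjoint hd] at this
  omega

theorem le_card_nonisolated (s : LeafStar G U j L W)
    (h : ∀ v ∈ W, G.Adj j v → v ∈ nonisolated G W) :
    (nonisolated G U).card ≤ (nonisolated G W).card + L.card + 1 := by
  have hsub : nonisolated G U ⊆ insert j (nonisolated G W ∪ L) := by
    intro v hv
    obtain ⟨hv, a, ha, hva⟩ := mem_nonisolated.mp hv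
    rw [s.eq_insert] at hv ha
    by_cases hvj : v = j
    · grind
    by_cases hvL : v ∈ L
    · grind
    have hvW : v ∈ W := by grind
    suffices v ∈ nonisolated G W by grind
    by_cases haj : a = j
    · subst haj; exact h v hvW hva.symm
    by_cases haL : a ∈ L
    · exact absurd hva.symm (s.leaf a haL v (by grind))
    · exact mem_nonisolated.mpr ⟨hvW, a, by grind, hva⟩
  refine (Finset.card_le_card hsub).trans ((Finset.card_insert_le _ _).trans ?_)
  have := Finset.card_union_le (nonisolated G W) L
  omega

theorem le_card_nonisolated_erase (s : LeafStar G U j L W) (hb : b ∈ W)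
    (hjW : ∀ v ∈ W.erase b, ¬ G.Adj j v) (hbW : b ∉ nonisolated G W) :
    (nonisolated G U).card ≤ (nonisolated G (W.erase b)).card + L.card + 2 := by
  have hsub : nonisolated G U ⊆ insert b (insert j (nonisolated G (W.erase b) ∪ L)) := by
    intro v hv
    obtain ⟨hv, a, ha, hva⟩ := mem_nonisolated.mp hv
    rw [s.eq_insert] at hv ha
    by_cases hvb : v = b
    · grind
    by_cases hvj : v = j
    · grind
    by_cases hvL : v ∈ L
    · grind
    have hvW : v ∈ W.erase b := by grind
    suffices v ∈ nonisolated G (W.erase b) by grind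
    by_cases haj : a = j
    · subst haj; exact absurd hva.symm (hjW v hvW)
    by_cases haL : a ∈ L
    · exact absurd hva.symm (s.leaf a haL v (by grind))
    by_cases hab : a = b
    · subst hab
      exact absurd (mem_nonisolated.mpr ⟨hb, v, by grind, hva.symm⟩) hbW
    · exact mem_nonisolated.mpr ⟨hvW, a, by grind, hva⟩
  refine (Finset.card_le_card hsub).trans ((Finset.card_insert_le _ _).trans ?_)
  have h1 := Finset.card_insert_le j (nonisolated G (W.erase b) ∪ L)
  have := Finset.card_union_le (nonisolated G (W.erase b)) L
  omega

theorem hasMatching_union_iff (s : LeafStar G U j L W) {k : ℕ} :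
    HasMatching G k (W ∪ L) ↔ HasMatching G k W := by
  have h := SetLike.ext_iff.mp (matchingFamily_union (G := G) k s.leaf) (W ∪ L)
  simpa [mem_matchingFamily] using h

/-- Some maximum matching contains an edge from the centre of the star to a leaf. -/
theorem hasMatching_succ_iff (s : LeafStar G U j L W) {k : ℕ} :
    HasMatching G (k + 1) U ↔ HasMatching G k W := by
  constructor
  · intro h
    rw [← s.hasMatching_union_iff]
    have := h.erase j
    rwa [s.eq_insert, Finset.erase_insert s.notMem] at this
  · intro h
    obtain ⟨i, hi⟩ := s.nonempty
    have h1 := s.notMem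
    have h2 := Finset.disjoint_right.mp s.disjoint hi
    refine (h.insert_edge (s.adj i hi) h2 (by grind)).mono ?_
    rw [s.eq_insert]
    intro v hv; grind

theorem ssubset (s : LeafStar G U j L W) : W ⊂ U := by
  have := s.notMem
  rw [s.eq_insert, Finset.ssubset_iff]
  exact ⟨j, by grind, by intro v hv; grind⟩

theorem matchingFamily_eq (s : LeafStar G U j L W) (k : ℕ) :
    restrict (matchingFamily G U k) j = matchingFamily G W k ∧
      colon (matchingFamily G U k) j = colonFamily G j (W ∪ L) k := by
  rw [restrict_matchingFamily, s.eq_insert, Finset.erase_insert s.notMem,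
    matchingFamily_union k s.leaf, colon_matchingFamily]
  exact ⟨rfl, rfl⟩

theorem depthGE (s : LeafStar G U j L W) {k t : ℕ}
    (h1 : DepthGE K (matchingFamily G W k) (t + L.card - 1))
    (h2 : DepthGE K (colonFamily G j W (k + 1)) (t + L.card))
    (h3 : DepthGE K (matchingFamily G W (k + 1)) (t + 1)) :
    DepthGE K (matchingFamily G U (k + 1)) t := by
  refine DepthGE.of_colon_of_restrict j ?_ ?_
  · rw [(s.matchingFamily_eq _).2]
    exact depthGE_colonFamily_union k L s.notMem s.disjoint s.adj s.leaf t h1 h2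
  · rwa [(s.matchingFamily_eq _).1]

theorem depthGE_colonFamily_of_depthGE [Fintype V] (s : LeafStar G U j L W) {k t : ℕ}
    (hM : HasMatching G k W) (h : DepthGE K (matchingFamily G U (k + 1)) t) :
    DepthGE K (colonFamily G j W (k + 1)) (t + L.card) ∧
      DepthGE K (matchingFamily G W k) (t + L.card - 1) := by
  have h' := h.colon j
  rw [(s.matchingFamily_eq _).2] at h'
  have := DepthGE.of_colonFamily_union hM s.unique L s.notMem s.disjoint s.adj s.leaf t h'
  exact ⟨this.1, this.2 s.nonempty⟩

theorem colon_restrict_colonFamily (s : LeafStar G U j L W) (hb : b ∈ W) (hjb : G.Adj j b)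
    (hjW : ∀ v ∈ W.erase b, ¬ G.Adj j v) (k : ℕ) :
    colon (colonFamily G j W (k + 1)) b = matchingFamily G (W.erase b) k ∧
      restrict (colonFamily G j W (k + 1)) b = matchingFamily G (W.erase b) (k + 1) := by
  have hj : j ∉ W.erase b := fun h =>
    s.notMem (Finset.mem_union_left _ (Finset.mem_of_mem_erase h))
  refine ⟨?_, ?_⟩
  · conv_lhs => rw [← Finset.insert_erase hb]
    exact colon_colonFamily k hjb.symm (Finset.notMem_erase b W) hj (Or.inr hjW)
  · rw [restrict_colonFamily, colonFamily_eq _ hj hjW]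

end LeafStar

variable {K : Type v} [Field K] [Fintype V]

/-- The depth of `S / I(G[U])^{[k]}` is at least `2k - 1` plus the number of variables that do not
occur in `I(G[U])`, for a forest `G`. -/
theorem depthGE_of_card_le (hG : G.IsAcyclic) (U : Finset V) : ∀ {k t : ℕ},
    HasMatching G (k + 1) U → t + (nonisolated G U).card ≤ Fintype.card V + 2 * k + 1 →
    DepthGE K (matchingFamily G U (k + 1)) t := by
  induction U using Finset.strongInduction with
  | H U ih =>
  intro k t hU ht
  obtain ⟨j, L, W, s⟩ := exists_leafStar hG (hU.of_le (by omega))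
  have hW := s.hasMatching_succ_iff.mp hU
  have hL := s.nonempty.card_pos
  have c0 := hU.two_mul_le_card
  have c1 := s.card_nonisolated_le
  have c2 := hW.two_mul_le_card
  -- the bound for `G[X]`, whether or not the ideal vanishes
  have step : ∀ X ⊂ U, ∀ m τ, (HasMatching G (m + 1) X →
      τ + (nonisolated G X).card ≤ Fintype.card V + 2 * m + 1) →
      (¬ HasMatching G (m + 1) X → τ ≤ Fintype.card V) →
      DepthGE K (matchingFamily G X (m + 1)) τ := by
    intro X hX m τ h1 h2
    by_cases hM : HasMatching G (m + 1) X
    · exact ih X hX hM (h1 hM)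
    · rw [matchingFamily_eq_top hM, depthGE_top_iff]
      exact h2 hM
  refine s.depthGE ?_ ?_ ?_
  · cases k with
    | zero => exact depthGE_matchingFamily_zero _ _
    | succ m => exact step W s.ssubset m _ (fun _ => by omega) fun h => absurd hW h
  · rcases s.forall_or_exists with hj | ⟨b, hb, hjb, hjW⟩
    · rw [colonFamily_eq _ (fun h => s.notMem (Finset.mem_union_left _ h)) hj]
      exact step W s.ssubset k _ (fun _ => by omega) fun _ => by omega
    · have c3 := s.card_nonisolated_erase_le hb hjb
      have hsub : W.erase b ⊂ U := (Finset.erase_subset b W).trans_ssubset s.ssubset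
      obtain ⟨e1, e2⟩ := s.colon_restrict_colonFamily hb hjb hjW k
      by_cases hM : HasMatching G k (W.erase b)
      · have c4 := hM.two_mul_le_card
        refine DepthGE.of_colon_of_restrict b ?_ ?_
        · rw [e1]
          cases k with
          | zero => exact depthGE_matchingFamily_zero _ _
          | succ m => exact step _ hsub m _ (fun _ => by omega) fun h => absurd hM h
        · rw [e2]
          exact step _ hsub k _ (fun _ => by omega) fun _ => by omega
      · rw [colonFamily_eq_top, depthGE_top_iff]
        · omega
        · intro hcon
          refine hM ?_
          have e : insert j W = insert b (insert j (W.erase b)) := by grind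
          rw [e] at hcon
          have hj : j ∉ W := fun h => s.notMem (Finset.mem_union_left _ h)
          exact (hasMatching_insert_edge_iff hjb.symm (Finset.notMem_erase b W) (by grind)
            (Or.inr hjW)).mp hcon
  · exact step W s.ssubset k _ (fun _ => by omega) fun _ => by omega

/-- For a forest `G` the bound of `depthGE_of_card_le` is attained at the matching number. -/
theorem DepthGE.card_le (hG : G.IsAcyclic) (U : Finset V) : ∀ {k t : ℕ},
    HasMatching G (k + 1) U → ¬ HasMatching G (k + 2) U →
    DepthGE K (matchingFamily G U (k + 1)) t →
    t + (nonisolated G U).card ≤ Fintype.card V + 2 * k + 1 := by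
  induction U using Finset.strongInduction with
  | H U ih =>
  intro k t hU hU' ht
  obtain ⟨j, L, W, s⟩ := exists_leafStar hG (hU.of_le (by omega))
  have hW := s.hasMatching_succ_iff.mp hU
  have hW' : ¬ HasMatching G (k + 1) W := fun h => hU' (s.hasMatching_succ_iff.mpr h)
  obtain ⟨h1, h2⟩ := s.depthGE_colonFamily_of_depthGE hW ht
  have hL := s.nonempty.card_pos
  have hjn : j ∉ W := fun h => s.notMem (Finset.mem_union_left _ h)
  cases k with
  | zero =>
    have hE : nonisolated G W = ∅ := by
      rw [Finset.eq_empty_iff_forall_notMem]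
      intro v hv
      obtain ⟨hv, a, ha, hva⟩ := mem_nonisolated.mp hv
      exact hW' ⟨v, hv, a, ha, hva, trivial⟩
    rcases s.forall_or_exists with hj | ⟨b, hb, hjb, hjW⟩
    · have c := s.le_card_nonisolated fun v hv hjv => absurd hjv (hj v hv)
      rw [colonFamily_eq _ hjn hj, matchingFamily_eq_top hW', depthGE_top_iff] at h1
      rw [hE, Finset.card_empty] at c
      omega
    · have c := s.le_card_nonisolated_erase hb hjW (by simp [hE])
      have hE' : nonisolated G (W.erase b) = ∅ :=
        Finset.subset_empty.mp (hE ▸ nonisolated_mono (Finset.erase_subset b W))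
      rw [hE', Finset.card_empty] at c
      have := h1.lt_card (A := W) (by
        rw [mem_colonFamily, Finset.inter_self]
        exact ⟨j, by simp, b, by simp [hb], hjb, trivial⟩) (by
        rw [mem_colonFamily, Finset.empty_inter]
        exact not_hasMatching_singleton j 0)
      omega
  | succ m =>
    rcases s.forall_or_exists with hj | ⟨b, hb, hjb, hjW⟩
    · have c := s.le_card_nonisolated fun v hv hjv => absurd hjv (hj v hv)
      have := ih W s.ssubset hW hW' h2
      omega
    · by_cases hbW : b ∈ nonisolated G W
      · have c := s.le_card_nonisolated fun v hv hjv => by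
          by_cases hvb : v = b
          · exact hvb ▸ hbW
          · exact absurd hjv (hjW v (Finset.mem_erase.mpr ⟨hvb, hv⟩))
        have := ih W s.ssubset hW hW' h2
        omega
      · have c := s.le_card_nonisolated_erase hb hjW hbW
        have hbiso : ∀ v ∈ W, ¬ G.Adj b v := fun v hv hbv =>
          hbW (mem_nonisolated.mpr ⟨hb, v, hv, hbv⟩)
        have h3 := h1.colon b
        rw [(s.colon_restrict_colonFamily hb hjb hjW _).1] at h3
        have := ih _ ((Finset.erase_subset b W).trans_ssubset s.ssubset)
          ((hasMatching_erase_iff hbiso).mpr hW) (fun h => hW' ((hasMatching_erase_iff hbiso).mp h))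
          h3
        omega

/-- The depth of `S / I(G[U])^{[k]}` grows by at most two from `k` to `k + 1`, for a forest `G`. -/
theorem DepthGE.matchingFamily_of_succ (hG : G.IsAcyclic) (U : Finset V) : ∀ {k t : ℕ},
    HasMatching G (k + 1) U → DepthGE K (matchingFamily G U (k + 1)) (t + 2) →
    DepthGE K (matchingFamily G U k) t := by
  induction U using Finset.strongInduction with
  | H U ih =>
  intro k t hU ht
  cases k with
  | zero => exact depthGE_matchingFamily_zero _ _
  | succ k =>
  obtain ⟨j, L, W, s⟩ := exists_leafStar hG (hU.of_le (by omega))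
  have hW := s.hasMatching_succ_iff.mp hU
  obtain ⟨h1, h2⟩ := s.depthGE_colonFamily_of_depthGE hW ht
  have hL := s.nonempty.card_pos
  have hjn : j ∉ W := fun h => s.notMem (Finset.mem_union_left _ h)
  refine s.depthGE (ih W s.ssubset hW (h2.mono (by omega))) ?_ (h2.mono (by omega))
  rcases s.forall_or_exists with hj | ⟨b, hb, hjb, hjW⟩
  · rw [colonFamily_eq _ hjn hj]
    exact h2.mono (by omega)
  have hsub : W.erase b ⊂ U := (Finset.erase_subset b W).trans_ssubset s.ssubset
  have e1 := (s.colon_restrict_colonFamily hb hjb hjW (k + 1)).1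
  obtain ⟨e2, e3⟩ := s.colon_restrict_colonFamily hb hjb hjW k
  refine DepthGE.of_colon_of_restrict b ?_ ?_
  · rw [e2]
    by_cases hM : HasMatching G (k + 1) (W.erase b)
    · refine ih _ hsub hM ?_
      rw [← e1]
      exact (h1.colon b).mono (by omega)
    · -- now `k` is the matching number of `G[W \ {b}]`, and `k + 2` is that of `G[U]`, so that
      -- the numbers of isolated vertices bound the two depths
      cases k with
      | zero => exact depthGE_matchingFamily_zero _ _
      | succ k =>
        have hU' : ¬ HasMatching G (k + 4) U := fun h =>
          hM ((s.hasMatching_succ_iff.mp h).erase b)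
        have c1 := ht.card_le hG U hU hU'
        have c2 := s.card_nonisolated_erase_le hb hjb
        exact depthGE_of_card_le hG _ (hW.erase b) (by omega)
  · rw [e3]
    exact (h2.matchingFamily_erase b).mono (by omega)

end

/-! ### The normalized depth function -/

section

theorem depthQuotient_matchingIdeal_succ_le {V : Type*} [Fintype V] (K : Type*) [Field K]
    {G : SimpleGraph V} (hG : G.IsAcyclic) {k : ℕ} (hk : 1 ≤ k) (hk' : k + 1 ≤ matchingNumber G) :
    (depthQuotient (matchingIdeal K G (k + 1))).toNat ≤
      (depthQuotient (matchingIdeal K G k)).toNat + 2 := by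
  classical
  obtain ⟨M, hM⟩ := exists_isKMatching hk'
  have hU : HasMatching G (k + 1) Finset.univ := hasMatching_iff.mpr ⟨M, hM, Finset.subset_univ _⟩
  have hempty : ∀ m, 1 ≤ m → ∅ ∉ matchingFamily G (Finset.univ : Finset V) m := by
    intro m hm h
    obtain ⟨m, rfl⟩ := Nat.exists_eq_add_of_le' hm
    exact not_hasMatching_empty m (by simpa [mem_matchingFamily] using h)
  have hiff : ∀ m, 1 ≤ m → ∀ t, DepthGE K (matchingFamily G Finset.univ m) t ↔
      t ≤ (depthQuotient (matchingIdeal K G m)).toNat := by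
    intro m hm t
    rw [depthGE_iff_le_depthQuotient (hempty m hm), monomialIdeal_matchingFamily,
      ← ENat.natCast_le_natCast, ENat.natCast_toNat (depthQuotient_ne_top _)]
  by_contra! hlt
  have h1 := (hiff (k + 1) (by omega) _).mpr le_rfl
  have h2 := (h1.mono (Nat.succ_le_of_lt hlt)).mono
    (show (depthQuotient (matchingIdeal K G k)).toNat + 1 + 2 ≤ _ by omega)
  have h3 := (hiff k hk _).mp (h2.matchingFamily_of_succ hG _ hU)
  omega

end

end SquarefreePowers

theorem mainTheorem1 {V : Type*} [Fintype V] (K : Type*) [Field K] (G : SimpleGraph V)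
    (hG : G.IsAcyclic) :
    AntitoneOn (SquarefreePowers.normalizedDepth (SquarefreePowers.edgeIdeal K G))
      (Set.Icc 1 (SquarefreePowers.matchingNumber G)) := by
  rintro k ⟨hk, -⟩ l ⟨-, hl⟩ hkl
  induction l, hkl using Nat.le_induction with
  | base => exact le_rfl
  | succ l hkl ih =>
    refine le_trans ?_ (ih (by omega))
    rw [SquarefreePowers.normalizedDepth_edgeIdeal K G hl,
      SquarefreePowers.normalizedDepth_edgeIdeal K G (by omega)]
    have := SquarefreePowers.depthQuotient_matchingIdeal_succ_le K hG (hk.trans hkl) hl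
    push_cast
    omega
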